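/- **Setting.** A latent MDP (LMDP) with finite state space $\mathcal S$ ($S=|\mathcal S|$), $A$ actions, $L$ MDP instances and horizon $H$ consists of a reward function $R=(R_h:\mathcal S\times\mathcal A\to[0,1])_{h=1}^H$, a mixing distribution $\rho\in\Delta([L])$, and, for each $m\in[L]$, a transition kernel $\mathbb T_m:\mathcal S\times\mathcal A\to\Delta(\mathcal S)$ and an initial distribution $\nu_m\in\Delta(\mathcal S)$. In each episode an unobserved index $m\sim\rho$ is drawn, then $s_1\sim\nu_m$, and $s_{h+1}\sim\mathbb T_m(\cdot\mid s_h,a_h)$ for $h<H$. Policies are randomized and history-dependent: $a_h\sim\pi_h(\cdot\mid s_1,a_1,\dots,s_{h-1},a_{h-1},s_h)$. The value of $\pi$ is $V(\pi)=\mathbb E^\pi[\sum_{h=1}^H R_h(s_h,a_h)]$, and $\pi$ is $\varepsilon$-optimal if $\sup_{\pi'}V(\pi')-V(\pi)\le\varepsilon$. The LMDP is $\delta$-strongly separated if $D_{\rm TV}(\mathbb T_m(\cdot\mid s,a),\mathbb T_l(\cdot\mid s,a))\ge\delta$ for all $m\ne l$ in $\mathrm{supp}(\rho)$ and all $s,a$.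 An algorithm with $T$ samples is a (possibly randomized) procedure that interacts with an LMDP for $T$ episodes, choosing the policy of each episode from the trajectories $(s_1,a_1,\dots,s_H,a_H)$ of the previous ones, and then outputs a policy. **Theorem.** There are absolute constants $C,K,c>0$ such that the following holds. Let $\delta\in(0,\frac1{4e^2}]$ and let $H\ge3$, $A\ge2$, $L$ be integers with $L\ge 2^{C\log^2(1/\delta)}$ and $$C\,H\log H\,\log(1/\delta)\le\frac{\log L}{\delta}.$$ Then there is a class $\mathcal M$ of $\delta$-strongly separated LMDPs, each with $L$ MDP instances, $A$ actions and horizon $H$, all with the same state space of size $S\le(\log L)^{K\log H}$ and the same reward function $R$, where $\sum_{h=1}^H\sup_{s,a}R_h(s,a)\le1$, such that every algorithm that, for each $M\in\mathcal M$, outputs a $\frac1{4H}$-optimal policy of $M$ with probability at least $\frac34$ after interacting with $M$ for $T$ episodes satisfies $T\ge c\,A^{H-2}$. -/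

import Mathlib

open MeasureTheory

noncomputable section

/-- Total variation distance between two probability vectors on a finite set. -/
def tvDist {X : Type} [Fintype X] (p q : stdSimplex ℝ X) : ℝ :=
  (1 / 2) * ∑ x, |p x - q x|

/-- A (time-homogeneous) MDP instance: transition kernel and initial state distribution. -/
structure MDP (𝒮 𝒜 : Type) [Fintype 𝒮] where
  trans : 𝒮 → 𝒜 → stdSimplex ℝ 𝒮
  init : stdSimplex ℝ 𝒮

/-- A latent MDP with `L` instances, mixing distribution and reward function
(steps `h = 1, …, H` are indexed by `Fin H`, starting from `0`). -/
structure LMDP (𝒮 𝒜 : Type) [Fintype 𝒮] (L H : ℕ) where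
  inst : Fin L → MDP 𝒮 𝒜
  mix : stdSimplex ℝ (Fin L)
  reward : Fin H → 𝒮 → 𝒜 → Set.Icc (0 : ℝ) 1

/-- A trajectory `(s₁, a₁, …, s_H, a_H)`. -/
abbrev Trajectory (𝒮 𝒜 : Type) (H : ℕ) : Type := Fin H → 𝒮 × 𝒜

/-- A randomized history-dependent policy: at each step it maps the preceding state-action pairs
and the current state to a distribution over actions. -/
abbrev Policy (𝒮 𝒜 : Type) [Fintype 𝒜] (H : ℕ) : Type :=
  (h : Fin H) → (Fin (h : ℕ) → 𝒮 × 𝒜) → 𝒮 → stdSimplex ℝ 𝒜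

/-- The first `k` entries of a finite sequence. -/
def pastOf {X : Type} {n : ℕ} (τ : Fin n → X) (k : Fin n) : Fin (k : ℕ) → X :=
  fun i => τ ⟨i, i.2.trans k.2⟩

/-- The probability that the MDP produces the state of step `h` of `τ`, given the preceding
state-action pair of `τ` (the initial probability at the first step). -/
def MDP.stepProb {𝒮 𝒜 : Type} [Fintype 𝒮] {H : ℕ} (N : MDP 𝒮 𝒜)
    (τ : Trajectory 𝒮 𝒜 H) : Fin H → ℝ
  | ⟨0, h0⟩ => N.init (τ ⟨0, h0⟩).1
  | ⟨k + 1, hk⟩ =>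
      N.trans (τ ⟨k, Nat.lt_of_succ_lt hk⟩).1 (τ ⟨k, Nat.lt_of_succ_lt hk⟩).2 (τ ⟨k + 1, hk⟩).1

namespace LMDP

variable {𝒮 𝒜 : Type} [Fintype 𝒮] [Fintype 𝒜] {L H : ℕ}

/-- `δ`-strong separation: any two distinct instances in the support of the mixing distribution
have transition distributions at total variation distance at least `δ`, at every state-action
pair. -/
def StronglySeparated (M : LMDP 𝒮 𝒜 L H) (δ : ℝ) : Prop :=
  ∀ m l : Fin L, M.mix m ≠ 0 → M.mix l ≠ 0 → m ≠ l →
    ∀ s a, δ ≤ tvDist ((M.inst m).trans s a) ((M.inst l).trans s a)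

/-- The probability of the trajectory `τ` when `π` is executed for one episode: the latent index is
drawn once, from the mixing distribution, and is not observed. -/
def trajProb (M : LMDP 𝒮 𝒜 L H) (π : Policy 𝒮 𝒜 H) (τ : Trajectory 𝒮 𝒜 H) : ℝ :=
  (∑ m, M.mix m * ∏ h, (M.inst m).stepProb τ h) * ∏ h, π h (pastOf τ h) (τ h).1 (τ h).2

/-- The expected total reward of a policy. -/
def value (M : LMDP 𝒮 𝒜 L H) (π : Policy 𝒮 𝒜 H) : ℝ :=
  ∑ τ : Trajectory 𝒮 𝒜 H, M.trajProb π τ * ∑ h, (M.reward h (τ h).1 (τ h).2 : ℝ)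

/-- The optimal value over all randomized history-dependent policies. -/
def optValue (M : LMDP 𝒮 𝒜 L H) : ℝ := ⨆ π : Policy 𝒮 𝒜 H, M.value π

/-- `π` is `ε`-optimal. -/
def IsNearOptimal (M : LMDP 𝒮 𝒜 L H) (ε : ℝ) (π : Policy 𝒮 𝒜 H) : Prop :=
  M.optValue - M.value π ≤ ε

end LMDP

/-- A learning algorithm that interacts for `T` episodes. It draws a random seed `ω : Ω` once (all
of its internal randomness); in episode `t` it executes a policy chosen from the seed and the
trajectories of the previous episodes, and it finally outputs a policy chosen from the seed and all
`T` trajectories. -/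
structure LearningAlg (Ω 𝒮 𝒜 : Type) [MeasurableSpace Ω] [Fintype 𝒜] (H T : ℕ) where
  explore : (t : Fin T) → (Fin (t : ℕ) → Trajectory 𝒮 𝒜 H) → Ω → Policy 𝒮 𝒜 H
  output : (Fin T → Trajectory 𝒮 𝒜 H) → Ω → Policy 𝒮 𝒜 H
  measurable_explore : ∀ t D h past s a, Measurable fun ω => (explore t D ω h past s a : ℝ)
  measurable_output : ∀ D h past s a, Measurable fun ω => (output D ω h past s a : ℝ)

namespace LearningAlg

variable {Ω 𝒮 𝒜 : Type} [MeasurableSpace Ω] [Fintype 𝒮] [Fintype 𝒜] {L H T : ℕ}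

/-- The probability of observing the trajectories `D` in `T` independent episodes of `M`, given the
seed `ω`. -/
def dataProb (alg : LearningAlg Ω 𝒮 𝒜 H T) (M : LMDP 𝒮 𝒜 L H) (ω : Ω)
    (D : Fin T → Trajectory 𝒮 𝒜 H) : ℝ :=
  ∏ t, M.trajProb (alg.explore t (pastOf D t) ω) (D t)

open Classical in
/-- The probability, over the seed and the interaction with `M`, that the output policy is
`ε`-optimal for `M`. -/
def successProb (alg : LearningAlg Ω 𝒮 𝒜 H T) (P : Measure Ω) (M : LMDP 𝒮 𝒜 L H) (ε : ℝ) : ℝ :=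
  ∫ ω, ∑ D : Fin T → Trajectory 𝒮 𝒜 H,
    (if M.IsNearOptimal ε (alg.output D ω) then alg.dataProb M ω D else 0) ∂P

end LearningAlg

end

/-! The hard instances are combination locks whose N = H - 1 correct actions form a secret. An
unobserved group i in {0, ..., N} is drawn uniformly, and the observed level of the lock advances as
long as group i is alive. The killing rule is balanced. Before the last level, whatever is played,
the groups alive at level k are those above k and exactly one group t ≤ k, with t = 0 iff every
action so far was correct. The number of survivors, and so the law of the levels, carries no
information on the secret until the lock is opened. At the last level only group 0 can survive, and
only if all actions were correct (`lockAlive_last`, `lockWeight_congr`).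

The transitions must still be δ-separated without revealing the group during an episode. Each group
therefore has a mixture of emission laws: single laws are δ-separated, the mixtures have disjoint
supports, yet all mixtures give H emissions the same law (`HiddenGroups`). Two such mixtures come
from linear algebra: with more laws than monomials of degree H in the masses of the symbols, some
nonzero signed combination has vanishing moments of order H, and its positive and negative parts are
normalized (`exists_indistinguishable_mixtures`). Enough separated laws come from an ℓ¹ packing of a
grid. Using one copy per binary digit of i turns two groups into H.

The optimal value is 1/H, so a 1/(4H)-optimal policy opens the lock with probability at least 3/4 in
the always-alive process, which is possible for one secret only. The data laws agree with that of a
lock that never opens, unless some episode plays the secret, and T episodes play at most T secrets.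
Summing the success probabilities over the secrets gives (3/4) A^(H-1) ≤ 1 + T
(`sum_event_le_one_add`, `HiddenGroups.pow_le_of_successProb`). -/

/-! ### Total mass of history-dependent processes -/

/-- The total mass of a process on a finite set built from normalized history-dependent kernels. -/
theorem sum_prod_pastOf_eq_one {X : Type} [Fintype X] (n : ℕ)
    (p : (k : Fin n) → (Fin (k : ℕ) → X) → X → ℝ) (hp : ∀ k past, ∑ x, p k past x = 1) :
    ∑ τ : Fin n → X, ∏ k, p k (pastOf τ k) (τ k) = 1 := by
  induction n with
  | zero => simp
  | succ n ih =>
    rw [← (Fin.snocEquiv (fun _ : Fin (n + 1) => X)).sum_comp, Fintype.sum_prod_type,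
      Finset.sum_comm, ← ih (fun k => p k.castSucc) (fun k => hp k.castSucc)]
    refine Finset.sum_congr rfl fun τ _ => ?_
    have hpast : ∀ (x : X) (k : Fin n),
        pastOf (Fin.snoc (α := fun _ => X) τ x) k.castSucc = pastOf τ k := by
      intro x k
      funext i
      have : (⟨i, i.2.trans k.castSucc.2⟩ : Fin (n + 1)) =
        (⟨i, i.2.trans k.2⟩ : Fin n).castSucc := rfl
      simp only [pastOf]
      rw [this, Fin.snoc_castSucc]
    have hlast : ∀ x : X, pastOf (Fin.snoc (α := fun _ => X) τ x) (Fin.last n) = τ := by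
      intro x
      funext i
      have : (⟨i, i.2.trans (Fin.last n).2⟩ : Fin (n + 1)) = Fin.castSucc (n := n) i := rfl
      simp only [pastOf]
      rw [this, Fin.snoc_castSucc]
    simp only [Fin.snocEquiv, Equiv.coe_fn_mk, Fin.prod_univ_castSucc, Fin.snoc_castSucc,
      Fin.snoc_last, hpast, hlast]
    rw [← Finset.mul_sum, hp, mul_one]

/-- The law of the state of step `h` given the preceding state-action pairs. -/
def MDP.stepKernel {𝒮 𝒜 : Type} [Fintype 𝒮] {H : ℕ} (N : MDP 𝒮 𝒜) :
    (h : Fin H) → (Fin (h : ℕ) → 𝒮 × 𝒜) → stdSimplex ℝ 𝒮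
  | ⟨0, _⟩, _ => N.init
  | ⟨k + 1, _⟩, past => N.trans (past ⟨k, Nat.lt_succ_self k⟩).1 (past ⟨k, Nat.lt_succ_self k⟩).2

theorem MDP.stepProb_eq {𝒮 𝒜 : Type} [Fintype 𝒮] {H : ℕ} (N : MDP 𝒮 𝒜)
    (τ : Trajectory 𝒮 𝒜 H) (h : Fin H) :
    N.stepProb τ h = N.stepKernel h (pastOf τ h) (τ h).1 := by
  obtain ⟨_ | k, hk⟩ := h <;> rfl

theorem sum_prod_kernel_policy {𝒮 𝒜 : Type} [Fintype 𝒮] [Fintype 𝒜] {H : ℕ}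
    (q : (h : Fin H) → (Fin (h : ℕ) → 𝒮 × 𝒜) → 𝒮 → ℝ) (hq : ∀ h past, ∑ s, q h past s = 1)
    (π : Policy 𝒮 𝒜 H) :
    ∑ τ : Trajectory 𝒮 𝒜 H, (∏ h, q h (pastOf τ h) (τ h).1) *
      ∏ h, π h (pastOf τ h) (τ h).1 (τ h).2 = 1 := by
  simp only [← Finset.prod_mul_distrib]
  refine sum_prod_pastOf_eq_one H
    (fun h past x => q h past x.1 * π h past x.1 x.2) fun h past => ?_
  rw [Fintype.sum_prod_type]
  simp only [← Finset.mul_sum, stdSimplex.sum_eq_one, mul_one, hq]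

theorem MDP.stepProb_nonneg {𝒮 𝒜 : Type} [Fintype 𝒮] {H : ℕ} (N : MDP 𝒮 𝒜)
    (τ : Trajectory 𝒮 𝒜 H) (h : Fin H) : 0 ≤ N.stepProb τ h := by
  rw [MDP.stepProb_eq]
  exact stdSimplex.zero_le _ _

namespace LMDP

variable {𝒮 𝒜 : Type} [Fintype 𝒮] [Fintype 𝒜] {L H : ℕ}

theorem trajProb_nonneg (M : LMDP 𝒮 𝒜 L H) (π : Policy 𝒮 𝒜 H) (τ : Trajectory 𝒮 𝒜 H) :
    0 ≤ M.trajProb π τ :=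
  mul_nonneg
    (Finset.sum_nonneg fun _ _ => mul_nonneg (stdSimplex.zero_le _ _)
      (Finset.prod_nonneg fun _ _ => MDP.stepProb_nonneg _ _ _))
    (Finset.prod_nonneg fun _ _ => stdSimplex.zero_le _ _)

theorem sum_trajProb (M : LMDP 𝒮 𝒜 L H) (π : Policy 𝒮 𝒜 H) : ∑ τ, M.trajProb π τ = 1 := by
  simp only [trajProb, Finset.sum_mul]
  rw [Finset.sum_comm, ← stdSimplex.sum_eq_one M.mix]
  refine Finset.sum_congr rfl fun m _ => ?_
  simp only [mul_assoc, ← Finset.mul_sum, MDP.stepProb_eq]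
  rw [sum_prod_kernel_policy (fun h past s => (M.inst m).stepKernel h past s)
    (fun h past => stdSimplex.sum_eq_one _), mul_one]

end LMDP

namespace LearningAlg

variable {Ω 𝒮 𝒜 : Type} [MeasurableSpace Ω] [Fintype 𝒮] [Fintype 𝒜] {L H T : ℕ}

theorem dataProb_nonneg (alg : LearningAlg Ω 𝒮 𝒜 H T) (M : LMDP 𝒮 𝒜 L H) (ω : Ω)
    (D : Fin T → Trajectory 𝒮 𝒜 H) : 0 ≤ alg.dataProb M ω D :=
  Finset.prod_nonneg fun _ _ => LMDP.trajProb_nonneg _ _ _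

theorem sum_dataProb (alg : LearningAlg Ω 𝒮 𝒜 H T) (M : LMDP 𝒮 𝒜 L H) (ω : Ω) :
    ∑ D, alg.dataProb M ω D = 1 :=
  sum_prod_pastOf_eq_one T (fun t past τ => M.trajProb (alg.explore t past ω) τ)
    fun _ _ => LMDP.sum_trajProb _ _

end LearningAlg

/-! ### Counting the secrets that an algorithm can find -/

/-- If two data laws agree off the event of hitting `s`, then the probabilities that an `s`-specific
event occurs sum to at most one plus the number of trials, provided that the events are disjoint
and each trial hits at most one `s`. -/
theorem sum_event_le_one_add {S D : Type} [Fintype S] [Fintype D] {T : ℕ}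
    (G : S → D → Prop) [∀ s d, Decidable (G s d)] (hit : S → D → Prop) [∀ s d, Decidable (hit s d)]
    (P : S → D → ℝ) (P₀ : D → ℝ) (hP : ∀ s d, 0 ≤ P s d) (hP₀ : ∀ d, 0 ≤ P₀ d)
    (sumP : ∀ s, ∑ d, P s d = 1) (sumP₀ : ∑ d, P₀ d = 1)
    (agree : ∀ s d, ¬ hit s d → P s d = P₀ d)
    (hG : ∀ d s s', G s d → G s' d → s = s')
    (hhit : ∀ d, (Finset.univ.filter fun s => hit s d).card ≤ T) :
    ∑ s, ∑ d, (if G s d then P s d else 0) ≤ 1 + T := by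
  -- Both laws have total mass one and agree off the event, so they give the event itself the same
  -- mass.
  have key : ∀ s, ∑ d, (if hit s d then P s d else 0) = ∑ d, (if hit s d then P₀ d else 0) := by
    intro s
    have h1 : ∑ d, (if hit s d then P s d else 0) + ∑ d, (if hit s d then 0 else P s d) = 1 := by
      rw [← Finset.sum_add_distrib, ← sumP s]
      exact Finset.sum_congr rfl fun d _ => by split_ifs <;> simp
    have h2 : ∑ d, (if hit s d then P₀ d else 0) + ∑ d, (if hit s d then 0 else P₀ d) = 1 := by
      rw [← Finset.sum_add_distrib, ← sumP₀]
      exact Finset.sum_congr rfl fun d _ => by split_ifs <;> simp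
    have h3 : ∑ d, (if hit s d then 0 else P s d) = ∑ d, (if hit s d then 0 else P₀ d) :=
      Finset.sum_congr rfl fun d _ => by
        split_ifs with h
        · rfl
        · exact agree s d h
    linarith
  calc ∑ s, ∑ d, (if G s d then P s d else 0)
      ≤ ∑ s, ∑ d, ((if G s d then P₀ d else 0) + (if hit s d then P s d else 0)) := by
        refine Finset.sum_le_sum fun s _ => Finset.sum_le_sum fun d _ => ?_
        have := hP s d
        have := hP₀ d
        by_cases h : hit s d
        · split_ifs <;> linarith
        · rw [agree s d h]
          split_ifs <;> linarith
    _ = ∑ d, P₀ d * (Finset.univ.filter fun s => G s d).card +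
          ∑ d, P₀ d * (Finset.univ.filter fun s => hit s d).card := by
        simp only [Finset.sum_add_distrib, key]
        congr 1
        all_goals
          rw [Finset.sum_comm]
          refine Finset.sum_congr rfl fun d _ => ?_
          rw [← Finset.sum_filter, Finset.sum_const, nsmul_eq_mul, mul_comm]
    _ ≤ ∑ d, P₀ d * 1 + ∑ d, P₀ d * T := by
        refine add_le_add (Finset.sum_le_sum fun d _ => ?_) (Finset.sum_le_sum fun d _ => ?_)
        · refine mul_le_mul_of_nonneg_left ?_ (hP₀ d)
          exact_mod_cast Finset.card_le_one.2 fun a ha b hb => hG d a b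
            (Finset.mem_filter.1 ha).2 (Finset.mem_filter.1 hb).2
        · exact mul_le_mul_of_nonneg_left (by exact_mod_cast hhit d) (hP₀ d)
    _ = 1 + T := by rw [← Finset.sum_mul, ← Finset.sum_mul, sumP₀]; ring

/-! ### The combination lock -/

/-- Whether instance `i` of the lock with secret `σ` stays alive when action `a` is played at
level `h`: the correct action only kills instance `h + 1`, a wrong one kills the instances `≤ h`, and
the last level `N - 1` also kills every instance but `0`. -/
def lockPasses {A : ℕ} (N : ℕ) (σ : ℕ → Option (Fin A)) (i h : ℕ) (a : Fin A) : Prop :=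
  ((σ h = some a ∧ i ≠ h + 1) ∨ (σ h ≠ some a ∧ h < i)) ∧ (h + 1 = N → i = 0)

/-- Instance `i` is alive at level `k` after the actions `a`. -/
def lockAlive {A : ℕ} (N : ℕ) (σ : ℕ → Option (Fin A)) (a : Fin (N + 1) → Fin A) (i k : ℕ) : Prop :=
  ∀ h : Fin (N + 1), (h : ℕ) < k → lockPasses N σ i h (a h)

/-- The actions `a` open the lock with secret `σ`. -/
def lockOpened {A : ℕ} (N : ℕ) (σ : ℕ → Option (Fin A)) (a : Fin (N + 1) → Fin A) : Prop :=
  ∀ h : Fin (N + 1), (h : ℕ) < N → σ h = some (a h)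

section Lock

variable {A N : ℕ} (σ : ℕ → Option (Fin A)) (a : Fin (N + 1) → Fin A)

theorem lockAlive_zero (i : ℕ) : lockAlive N σ a i 0 := fun _ hh => absurd hh (Nat.not_lt_zero _)

theorem lockAlive_anti {i k l : ℕ} (hkl : k ≤ l) (h : lockAlive N σ a i l) :
    lockAlive N σ a i k := fun j hj => h j (hj.trans_le hkl)

theorem lockAlive_succ (i : ℕ) (k : Fin (N + 1)) :
    lockAlive N σ a i (k + 1) ↔ lockAlive N σ a i k ∧ lockPasses N σ i k (a k) := by
  constructor
  · exact fun h => ⟨lockAlive_anti σ a (Nat.le_succ _) h, h k (Nat.lt_succ_self _)⟩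
  · rintro ⟨h1, h2⟩ j hj
    rcases Nat.lt_succ_iff_lt_or_eq.1 hj with h | h
    · exact h1 j h
    · rw [Fin.ext h]
      exact h2

/-- A correct action at level k keeps t and kills k + 1; a wrong one kills t and spares k + 1, which
becomes the new t. Either way exactly one survivor has index at most k + 1. Index 0, once lost, is
never regained. -/
theorem exists_lockAlive_iff (k : ℕ) (hk : k < N) :
    ∃ t ≤ k, (∀ i, lockAlive N σ a i k ↔ i = t ∨ k < i) ∧
      (t = 0 ↔ ∀ h : Fin (N + 1), (h : ℕ) < k → σ h = some (a h)) := by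
  induction k with
  | zero =>
    refine ⟨0, le_rfl, fun i => ?_, by simp⟩
    simp only [lockAlive_zero, true_iff]
    omega
  | succ k ih =>
    obtain ⟨t, ht, h1, h2⟩ := ih (Nat.lt_of_succ_lt hk)
    have hs := fun i => lockAlive_succ σ a i ⟨k, by omega⟩
    have hall : (∀ h : Fin (N + 1), (h : ℕ) < k + 1 → σ h = some (a h)) ↔
        (∀ h : Fin (N + 1), (h : ℕ) < k → σ h = some (a h)) ∧
          σ k = some (a ⟨k, by omega⟩) := by
      constructor
      · exact fun h => ⟨fun j hj => h j (by omega), h ⟨k, by omega⟩ (Nat.lt_succ_self _)⟩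
      · rintro ⟨h3, h4⟩ j hj
        rcases Nat.lt_succ_iff_lt_or_eq.1 hj with h | h
        · exact h3 j h
        · have : j = ⟨k, by omega⟩ := Fin.ext h
          rw [this]
          exact h4
    by_cases hc : σ k = some (a ⟨k, by omega⟩)
    · refine ⟨t, by omega, fun i => ?_, ?_⟩
      · rw [hs i, h1 i, lockPasses]
        simp only [hc, ne_eq, not_true_eq_false, false_and, or_false, true_and]
        omega
      · rw [hall, h2]
        simp [hc]
    · refine ⟨k + 1, le_rfl, fun i => ?_, ?_⟩
      · rw [hs i, h1 i, lockPasses]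
        simp only [hc, ne_eq, not_false_eq_true, false_and, true_and, false_or]
        omega
      · rw [hall]
        simp [hc]

/-- Just before the last action only t and N are alive. That action also kills every nonzero index,
which leaves 0 if t = 0 and the action is correct, and nothing otherwise. -/
theorem lockAlive_last (hN : 0 < N) (i : ℕ) :
    lockAlive N σ a i N ↔ i = 0 ∧ lockOpened N σ a := by
  obtain ⟨n, rfl⟩ : ∃ n, N = n + 1 := ⟨N - 1, by omega⟩
  obtain ⟨t, ht, h1, h2⟩ := exists_lockAlive_iff σ a n (Nat.lt_succ_self n)
  have hs := lockAlive_succ σ a i ⟨n, by omega⟩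
  simp only at hs
  rw [hs, h1, lockPasses]
  simp only [forall_const]
  constructor
  · rintro ⟨h3, h4, rfl⟩
    have ht0 : t = 0 := by omega
    refine ⟨rfl, fun h hh => ?_⟩
    rcases Nat.lt_succ_iff_lt_or_eq.1 hh with h' | h'
    · exact h2.1 ht0 h h'
    · have : h = ⟨n, by omega⟩ := Fin.ext h'
      rw [this]
      rcases h4 with h4 | h4
      · exact h4.1
      · omega
  · rintro ⟨rfl, h3⟩
    refine ⟨Or.inl (h2.2 fun h hh => h3 h (by omega)).symm, Or.inl ⟨?_, by omega⟩, rfl⟩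
    exact h3 ⟨n, by omega⟩ (Nat.lt_succ_self n)

open Classical in
/-- The number of instances alive at a level does not depend on the secret, as long as the lock is
not opened. -/
theorem card_lockAlive_congr (hN : 0 < N) {σ σ' : ℕ → Option (Fin A)} {a : Fin (N + 1) → Fin A}
    (h : ¬ lockOpened N σ a) (h' : ¬ lockOpened N σ' a) (k : Fin (N + 1)) :
    (Finset.univ.filter fun i : Fin (N + 1) => lockAlive N σ a i k).card =
      (Finset.univ.filter fun i : Fin (N + 1) => lockAlive N σ' a i k).card := by
  have hcard : ∀ σ : ℕ → Option (Fin A), (k : ℕ) < N →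
      (Finset.univ.filter fun i : Fin (N + 1) => lockAlive N σ a i k).card =
        (Finset.univ.filter fun i : Fin (N + 1) => k < i).card + 1 := by
    intro σ hk
    obtain ⟨t, ht, h1, -⟩ := exists_lockAlive_iff σ a k hk
    have : (Finset.univ.filter fun i : Fin (N + 1) => lockAlive N σ a i k) =
        insert ⟨t, by omega⟩ (Finset.univ.filter fun i : Fin (N + 1) => k < i) := by
      ext i
      simp only [h1, Finset.mem_filter, Finset.mem_univ, true_and, Finset.mem_insert,
        Fin.ext_iff, Fin.lt_def]
    rw [this, Finset.card_insert_of_notMem]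
    simp only [Finset.mem_filter, Finset.mem_univ, true_and, Fin.lt_def]
    omega
  rcases Nat.lt_succ_iff_lt_or_eq.1 k.2 with hk | hk
  · rw [hcard σ hk, hcard σ' hk]
  · simp [hk, lockAlive_last _ _ hN, h, h']

open Classical in
theorem card_lockAlive_last (hN : 0 < N) :
    (Finset.univ.filter fun i : Fin (N + 1) => lockAlive N σ a i N).card =
      if lockOpened N σ a then 1 else 0 := by
  simp only [lockAlive_last σ a hN]
  split_ifs with h
  · rw [Finset.card_eq_one]
    refine ⟨0, ?_⟩
    ext i
    simp [h]
  · simp [h]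

end Lock

/-- A sum of products along a decreasing chain of events depends only on the cardinalities. -/
theorem sum_prod_antitone_congr {ι : Type} [Fintype ι] [DecidableEq ι] {S S' : ℕ → Finset ι}
    (hS : Antitone S) (hS' : Antitone S') (n : ℕ) (hc : ∀ k < n, (S k).card = (S' k).card)
    (u v : ℕ → ℝ) :
    ∑ i, ∏ k ∈ Finset.range n, (if i ∈ S k then u k else v k) =
      ∑ i, ∏ k ∈ Finset.range n, (if i ∈ S' k then u k else v k) := by
  -- The last factor is v n plus (u n - v n) times the indicator of S n. For i in S n all earlier
  -- factors equal u k, because the chain decreases; hence only the cardinality of S n enters.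
  have step : ∀ S : ℕ → Finset ι, Antitone S → ∀ n,
      ∑ i, ∏ k ∈ Finset.range (n + 1), (if i ∈ S k then u k else v k) =
        v n * (∑ i, ∏ k ∈ Finset.range n, (if i ∈ S k then u k else v k)) +
          (u n - v n) * ((S n).card * ∏ k ∈ Finset.range n, u k) := by
    intro S hS n
    have h1 : ((S n).card : ℝ) * ∏ k ∈ Finset.range n, u k =
        ∑ i, if i ∈ S n then ∏ k ∈ Finset.range n, (if i ∈ S k then u k else v k) else 0 := by
      rw [← Finset.sum_filter, ← nsmul_eq_mul, ← Finset.sum_const]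
      refine Finset.sum_congr (by ext; simp) fun i hi => Finset.prod_congr rfl fun k hk => ?_
      rw [if_pos (hS (Finset.mem_range.1 hk).le (Finset.mem_filter.1 hi).2)]
    rw [h1, Finset.mul_sum, Finset.mul_sum, ← Finset.sum_add_distrib]
    refine Finset.sum_congr rfl fun i _ => ?_
    rw [Finset.prod_range_succ]
    split_ifs <;> ring
  induction n with
  | zero => simp
  | succ n ih =>
    rw [step S hS, step S' hS', ih fun k hk => hc k (Nat.lt_succ_of_lt hk), hc n (Nat.lt_succ_self n)]

open Classical in
/-- The level displayed by instance `i` at step `k`; `none` stands for a dead instance. -/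
noncomputable def lockPath {A : ℕ} (N : ℕ) (σ : ℕ → Option (Fin A)) (a : Fin (N + 1) → Fin A)
    (i : ℕ) (k : Fin (N + 1)) : Option (Fin (N + 1)) :=
  if lockAlive N σ a i k then some k else none

/-- The number of instances that display the levels `v` under the actions `a`. -/
noncomputable def lockWeight {A : ℕ} (N : ℕ) (σ : ℕ → Option (Fin A)) (a : Fin (N + 1) → Fin A)
    (v : Fin (N + 1) → Option (Fin (N + 1))) : ℝ :=
  ∑ i : Fin (N + 1), ∏ k, if v k = lockPath N σ a i k then 1 else 0

/-- The alive sets form a decreasing chain whose cardinalities do not depend on the secret while the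
lock stays shut, and the weight depends on these cardinalities alone. -/
theorem lockWeight_congr {A N : ℕ} (hN : 0 < N) {σ σ' : ℕ → Option (Fin A)}
    {a : Fin (N + 1) → Fin A} (h : ¬ lockOpened N σ a) (h' : ¬ lockOpened N σ' a)
    (v : Fin (N + 1) → Option (Fin (N + 1))) : lockWeight N σ a v = lockWeight N σ' a v := by
  classical
  set S : (ℕ → Option (Fin A)) → ℕ → Finset (Fin (N + 1)) :=
    fun σ k => Finset.univ.filter fun i : Fin (N + 1) => lockAlive N σ a i k with hS
  have anti : ∀ σ, Antitone (S σ) := fun σ k l hkl i hi => by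
    simp only [hS, Finset.mem_filter, Finset.mem_univ, true_and] at hi ⊢
    exact lockAlive_anti σ a hkl hi
  let u : ℕ → ℝ := fun k => if hk : k < N + 1 then if v ⟨k, hk⟩ = some ⟨k, hk⟩ then 1 else 0 else 0
  let w : ℕ → ℝ := fun k => if hk : k < N + 1 then if v ⟨k, hk⟩ = none then 1 else 0 else 0
  have hw : ∀ σ, lockWeight N σ a v =
      ∑ i, ∏ k ∈ Finset.range (N + 1), (if i ∈ S σ k then u k else w k) := by
    intro σ
    refine Finset.sum_congr rfl fun i _ => ?_
    rw [Finset.prod_range]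
    refine Finset.prod_congr rfl fun k _ => ?_
    by_cases hk : lockAlive N σ a i k <;> simp [hS, hk, lockPath, u, w] <;>
      exact fun h => absurd k.2 (by omega)
  rw [hw, hw]
  exact sum_prod_antitone_congr (anti σ) (anti σ') _
    (fun k hk => card_lockAlive_congr hN h h' ⟨k, hk⟩) u w

/-- Displaying the last level at the end forces survival throughout, which only instance 0 of an
opened lock achieves. -/
theorem lockWeight_of_last {A N : ℕ} (hN : 0 < N) (σ : ℕ → Option (Fin A))
    (a : Fin (N + 1) → Fin A) (v : Fin (N + 1) → Option (Fin (N + 1)))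
    (hv : v (Fin.last N) = some (Fin.last N)) [Decidable (lockOpened N σ a)] :
    lockWeight N σ a v = (∏ k, if v k = some k then 1 else 0) * if lockOpened N σ a then 1 else 0 := by
  classical
  have h1 : ∀ i : ℕ, (∀ k, v k = lockPath N σ a i k) ↔ (∀ k, v k = some k) ∧ lockAlive N σ a i N := by
    intro i
    have hval : ((Fin.last N : Fin (N + 1)) : ℕ) = N := rfl
    constructor
    · intro h
      have hl : lockAlive N σ a i N := by
        have := h (Fin.last N)
        rw [hv, lockPath] at this
        by_contra hc
        simp [hc] at this
      refine ⟨fun k => ?_, hl⟩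
      rw [h k, lockPath, if_pos (lockAlive_anti σ a (Nat.lt_succ_iff.1 k.2) hl)]
    · rintro ⟨h1, h2⟩ k
      rw [h1 k, lockPath, if_pos (lockAlive_anti σ a (Nat.lt_succ_iff.1 k.2) h2)]
  have h2 := card_lockAlive_last σ a hN
  simp only [lockWeight, Fintype.prod_boole, h1]
  by_cases hall : ∀ k, v k = some k
  · simp only [hall, true_and, forall_const, if_true, one_mul]
    rw [Finset.sum_boole, h2]
    split_ifs <;> simp
  · simp [hall]

/-! ### Latent MDPs indexed by a finite type -/

/-- The image of a probability vector under a map. -/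
noncomputable def pushVector {ι : Type} [Fintype ι] {L : ℕ} (e : ι → Fin L) (w : stdSimplex ℝ ι) :
    stdSimplex ℝ (Fin L) :=
  ⟨fun m => ∑ i, if e i = m then w i else 0,
    fun m => Finset.sum_nonneg fun i _ => by split_ifs <;> simp, by
    rw [Finset.sum_comm]
    simp⟩

/-- The latent MDP whose instances are indexed by a type embedded into `Fin L`; the other indices
have probability zero. -/
noncomputable def LMDP.ofEmbedding {𝒮 𝒜 ι : Type} [Fintype 𝒮] [Fintype ι] [Nonempty ι] {L H : ℕ}
    (e : ι ↪ Fin L) (inst : ι → MDP 𝒮 𝒜) (w : stdSimplex ℝ ι)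
    (R : Fin H → 𝒮 → 𝒜 → Set.Icc (0 : ℝ) 1) : LMDP 𝒮 𝒜 L H where
  inst m := inst (Function.invFun e m)
  mix := pushVector e w
  reward := R

theorem LMDP.trajProb_ofEmbedding {𝒮 𝒜 ι : Type} [Fintype 𝒮] [Fintype 𝒜] [Fintype ι] [Nonempty ι]
    {L H : ℕ} (e : ι ↪ Fin L) (inst : ι → MDP 𝒮 𝒜) (w : stdSimplex ℝ ι)
    (R : Fin H → 𝒮 → 𝒜 → Set.Icc (0 : ℝ) 1) (π : Policy 𝒮 𝒜 H) (τ : Trajectory 𝒮 𝒜 H) :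
    (LMDP.ofEmbedding e inst w R).trajProb π τ =
      (∑ i, w i * ∏ h, (inst i).stepProb τ h) * ∏ h, π h (pastOf τ h) (τ h).1 (τ h).2 := by
  have hinv := Function.leftInverse_invFun e.injective
  have hmix : ∀ m, (pushVector e w) m = ∑ i, if e i = m then w i else 0 := fun _ => rfl
  simp only [LMDP.trajProb, LMDP.ofEmbedding, hmix]
  congr 1
  simp only [Finset.sum_mul]
  rw [Finset.sum_comm]
  refine Finset.sum_congr rfl fun i _ => ?_
  simp [ite_mul, hinv i]

theorem LMDP.stronglySeparated_ofEmbedding {𝒮 𝒜 ι : Type} [Fintype 𝒮] [Fintype 𝒜] [Fintype ι]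
    [Nonempty ι] {L H : ℕ} (e : ι ↪ Fin L) (inst : ι → MDP 𝒮 𝒜) (w : stdSimplex ℝ ι)
    (R : Fin H → 𝒮 → 𝒜 → Set.Icc (0 : ℝ) 1) {δ : ℝ}
    (hsep : ∀ i j, w i ≠ 0 → w j ≠ 0 → i ≠ j → ∀ s a,
      δ ≤ tvDist ((inst i).trans s a) ((inst j).trans s a)) :
    (LMDP.ofEmbedding e inst w R).StronglySeparated δ := by
  have hsupp : ∀ m, (pushVector e w) m ≠ 0 → ∃ i, e i = m ∧ w i ≠ 0 := by
    intro m hm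
    obtain ⟨i, -, hi⟩ := Finset.exists_ne_zero_of_sum_ne_zero hm
    by_cases h : e i = m
    · exact ⟨i, h, by simpa [h] using hi⟩
    · simp [h] at hi
  intro m l hm hl hml s a
  obtain ⟨i, rfl, hi⟩ := hsupp m hm
  obtain ⟨j, rfl, hj⟩ := hsupp l hl
  have hinv := Function.leftInverse_invFun e.injective
  simp only [LMDP.ofEmbedding, hinv i, hinv j]
  exact hsep i j hi hj (fun h => hml (h ▸ rfl)) s a

/-! ### The lock with emissions -/

/-- The product of a point mass and a probability vector. -/
noncomputable def emitAt {V O : Type} [Fintype V] [DecidableEq V] [Fintype O] (v : V)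
    (p : stdSimplex ℝ O) : stdSimplex ℝ (V × O) :=
  ⟨fun y => (if y.1 = v then 1 else 0) * p y.2,
    fun y => mul_nonneg (by split_ifs <;> simp) (stdSimplex.zero_le _ _), by
    rw [Fintype.sum_prod_type]
    simp⟩

theorem emitAt_apply {V O : Type} [Fintype V] [DecidableEq V] [Fintype O] (v : V)
    (p : stdSimplex ℝ O) (y : V × O) :
    emitAt v p y = (if y.1 = v then 1 else 0) * p y.2 := rfl

/-- Total variation distance does not increase under a coordinate projection. -/
theorem tvDist_le_of_marginal {X Y : Type} [Fintype X] [Fintype Y] [DecidableEq Y] (f : X → Y)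
    (p q : stdSimplex ℝ X) (p' q' : stdSimplex ℝ Y)
    (hp : ∀ y, p' y = ∑ x, if f x = y then p x else 0)
    (hq : ∀ y, q' y = ∑ x, if f x = y then q x else 0) : tvDist p' q' ≤ tvDist p q := by
  unfold tvDist
  refine mul_le_mul_of_nonneg_left ?_ (by norm_num)
  calc ∑ y, |p' y - q' y| ≤ ∑ y, ∑ x, (if f x = y then |p x - q x| else 0) := by
        refine Finset.sum_le_sum fun y _ => ?_
        rw [hp, hq, ← Finset.sum_sub_distrib]
        refine (Finset.abs_sum_le_sum_abs _ _).trans (Finset.sum_le_sum fun x _ => ?_)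
        split_ifs <;> simp
    _ = ∑ x, |p x - q x| := by
        rw [Finset.sum_comm]
        simp

theorem tvDist_le_emitAt {V O : Type} [Fintype V] [DecidableEq V] [Fintype O] (v v' : V)
    (p q : stdSimplex ℝ O) : tvDist p q ≤ tvDist (emitAt v p) (emitAt v' q) := by
  classical
  refine tvDist_le_of_marginal Prod.snd _ _ _ _ (fun y => ?_) (fun y => ?_) <;>
  · rw [Fintype.sum_prod_type]
    simp [emitAt_apply]

section LockMDP

variable {A N : ℕ}

open Classical in
/-- The level that follows level `v` in instance `i` of the lock. -/
noncomputable def lockNext (N : ℕ) (σ : ℕ → Option (Fin A)) (i : ℕ) :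
    Option (Fin (N + 1)) → Fin A → Option (Fin (N + 1))
  | none, _ => none
  | some h, a =>
      if hh : (h : ℕ) < N ∧ lockPasses N σ i h a then some ⟨h + 1, Nat.succ_lt_succ hh.1⟩ else none

theorem lockPath_zero (σ : ℕ → Option (Fin A)) (a : Fin (N + 1) → Fin A) (i : ℕ) :
    lockPath N σ a i 0 = some 0 := by
  rw [lockPath, if_pos]
  exact lockAlive_zero σ a i

theorem lockPath_succ (σ : ℕ → Option (Fin A)) (a : Fin (N + 1) → Fin A) (i : ℕ) (k : Fin N) :
    lockPath N σ a i k.succ = lockNext N σ i (lockPath N σ a i k.castSucc) (a k.castSucc) := by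
  have h := lockAlive_succ σ a i k.castSucc
  simp only [Fin.val_castSucc] at h
  by_cases h1 : lockAlive N σ a i k
  · by_cases h2 : lockPasses N σ i k (a k.castSucc)
    · simp [lockPath, lockNext, h, h1, h2, Fin.ext_iff]
    · simp [lockPath, lockNext, h, h1, h2]
  · simp [lockPath, lockNext, h, h1]

/-- Instance `i` of the lock, which also emits independent observations with law `p`. -/
noncomputable def lockMDP {O : Type} [Fintype O] (N : ℕ) (σ : ℕ → Option (Fin A)) (i : ℕ)
    (p : stdSimplex ℝ O) : MDP (Option (Fin (N + 1)) × O) (Fin A) where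
  trans s a := emitAt (lockNext N σ i s.1 a) p
  init := emitAt (some 0) p

/-- Levels are deterministic given the actions and emissions are independent of both, so the
probability factorizes; this separates the secret from the emission parameter. -/
theorem prod_stepProb_lockMDP {O : Type} [Fintype O] (σ : ℕ → Option (Fin A)) (i : ℕ)
    (p : stdSimplex ℝ O) (τ : Trajectory (Option (Fin (N + 1)) × O) (Fin A) (N + 1)) :
    ∏ h, (lockMDP N σ i p).stepProb τ h =
      (∏ k, if (τ k).1.1 = lockPath N σ (fun k => (τ k).2) i k then 1 else 0) *
        ∏ k, p (τ k).1.2 := by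
  have h0 : (lockMDP N σ i p).stepProb τ 0 =
      (if (τ 0).1.1 = some 0 then 1 else 0) * p (τ 0).1.2 := rfl
  have hs : ∀ k : Fin N, (lockMDP N σ i p).stepProb τ k.succ =
      (if (τ k.succ).1.1 = lockNext N σ i (τ k.castSucc).1.1 (τ k.castSucc).2 then 1 else 0) *
        p (τ k.succ).1.2 := fun _ => rfl
  rw [Fin.prod_univ_succ, h0]
  simp only [hs]
  rw [Finset.prod_mul_distrib, Fin.prod_univ_succ (fun k => p (τ k).1.2), mul_mul_mul_comm]
  congr 1
  have hiff : ((τ 0).1.1 = some 0 ∧ ∀ k : Fin N,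
      (τ k.succ).1.1 = lockNext N σ i (τ k.castSucc).1.1 (τ k.castSucc).2) ↔
      ∀ k, (τ k).1.1 = lockPath N σ (fun k => (τ k).2) i k := by
    constructor
    · rintro ⟨h1, h2⟩ k
      induction k using Fin.induction with
      | zero => rw [h1, lockPath_zero]
      | succ k ih => rw [h2 k, lockPath_succ, ih]
    · intro h
      refine ⟨by rw [h 0, lockPath_zero], fun k => ?_⟩
      rw [h k.succ, lockPath_succ, h k.castSucc]
  rw [Fintype.prod_boole, Fintype.prod_boole]
  by_cases h : ∀ k, (τ k).1.1 = lockPath N σ (fun k => (τ k).2) i k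
  · rw [if_pos h, if_pos (hiff.2 h).1, if_pos (hiff.2 h).2, mul_one]
  · rw [if_neg h]
    rcases not_and_or.1 (mt hiff.1 h) with h | h
    · rw [if_neg h, zero_mul]
    · rw [if_neg h, mul_zero]

end LockMDP

/-- The reward is collected at the last step, in the states that display the last level. -/
noncomputable def lockReward (A N : ℕ) (O : Type) :
    Fin (N + 1) → Option (Fin (N + 1)) × O → Fin A → Set.Icc (0 : ℝ) 1 :=
  fun h s _ => if h = Fin.last N ∧ s.1 = some (Fin.last N) then 1 else 0

theorem sum_lockReward {A N : ℕ} {O : Type}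
    (τ : Trajectory (Option (Fin (N + 1)) × O) (Fin A) (N + 1)) :
    ∑ h, (lockReward A N O h (τ h).1 (τ h).2 : ℝ) =
      if (τ (Fin.last N)).1.1 = some (Fin.last N) then 1 else 0 := by
  rw [Finset.sum_eq_single (Fin.last N)]
  · simp only [lockReward, true_and]
    split_ifs <;> rfl
  · intro h _ hh
    simp [lockReward, hh]
  · simp

/-! ### Locks with hidden groups and their lower bound -/

/-- Families of emission laws, one mixture for each of `G` groups, such that `H` independent emissions
do not reveal the group while single emissions of distinct parameters are `δ`-separated. -/
structure HiddenGroups (δ : ℝ) (H G : ℕ) (O X : Type) [Fintype O] [Fintype X] where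
  law : X → stdSimplex ℝ O
  mixture : Fin G → stdSimplex ℝ X
  indistinguishable : ∀ (i j : Fin G) (o : Fin H → O),
    ∑ x, mixture i x * ∏ h, law x (o h) = ∑ x, mixture j x * ∏ h, law x (o h)
  disjoint : ∀ (i j : Fin G) (x : X), mixture i x ≠ 0 → mixture j x ≠ 0 → i = j
  separated : ∀ x y : X, x ≠ y → δ ≤ tvDist (law x) (law y)

namespace HiddenGroups

variable {δ : ℝ} {A N L : ℕ} {O X : Type} [Fintype O] [Fintype X]

/-- The group is uniform, and the parameter is drawn from the mixture of the group. -/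
noncomputable def weight (F : HiddenGroups δ (N + 1) (N + 1) O X) :
    stdSimplex ℝ (Fin (N + 1) × X) :=
  ⟨fun y => ((N : ℝ) + 1)⁻¹ * F.mixture y.1 y.2,
    fun y => mul_nonneg (by positivity) (stdSimplex.zero_le _ _), by
    rw [Fintype.sum_prod_type]
    simp only [← Finset.mul_sum, stdSimplex.sum_eq_one]
    simp
    field_simp⟩

/-- The probability of a sequence of emissions. -/
noncomputable def emissionProb (F : HiddenGroups δ (N + 1) (N + 1) O X) (o : Fin (N + 1) → O) : ℝ :=
  ∑ x, F.mixture 0 x * ∏ h, F.law x (o h)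

theorem emissionProb_nonneg (F : HiddenGroups δ (N + 1) (N + 1) O X) (o : Fin (N + 1) → O) :
    0 ≤ F.emissionProb o :=
  Finset.sum_nonneg fun _ _ => mul_nonneg (stdSimplex.zero_le _ _)
    (Finset.prod_nonneg fun _ _ => stdSimplex.zero_le _ _)

/-- The probability of a trajectory when the lock stays alive whatever is played. -/
noncomputable def aliveProb (F : HiddenGroups δ (N + 1) (N + 1) O X)
    (π : Policy (Option (Fin (N + 1)) × O) (Fin A) (N + 1))
    (τ : Trajectory (Option (Fin (N + 1)) × O) (Fin A) (N + 1)) : ℝ :=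
  (∏ k, if (τ k).1.1 = some k then 1 else 0) *
    F.emissionProb (fun k => (τ k).1.2) * ∏ h, π h (pastOf τ h) (τ h).1 (τ h).2

theorem aliveProb_nonneg (F : HiddenGroups δ (N + 1) (N + 1) O X)
    (π : Policy (Option (Fin (N + 1)) × O) (Fin A) (N + 1))
    (τ : Trajectory (Option (Fin (N + 1)) × O) (Fin A) (N + 1)) : 0 ≤ F.aliveProb π τ :=
  mul_nonneg (mul_nonneg (Finset.prod_nonneg fun _ _ => by split_ifs <;> simp)
    (F.emissionProb_nonneg _)) (Finset.prod_nonneg fun _ _ => stdSimplex.zero_le _ _)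

theorem sum_aliveProb (F : HiddenGroups δ (N + 1) (N + 1) O X)
    (π : Policy (Option (Fin (N + 1)) × O) (Fin A) (N + 1)) : ∑ τ, F.aliveProb π τ = 1 := by
  simp only [aliveProb, emissionProb, Finset.mul_sum, Finset.sum_mul]
  rw [Finset.sum_comm]
  refine Eq.trans (Finset.sum_congr rfl fun x _ => ?_) (stdSimplex.sum_eq_one (F.mixture 0))
  have h := sum_prod_kernel_policy
    (fun (k : Fin (N + 1)) _ (s : Option (Fin (N + 1)) × O) => emitAt (some k) (F.law x) s)
    (fun k _ => stdSimplex.sum_eq_one _) π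
  refine Eq.trans ?_ ((congrArg (F.mixture 0 x * ·) h).trans (mul_one _))
  simp only [Finset.mul_sum]
  refine Finset.sum_congr rfl fun τ _ => ?_
  simp only [emitAt_apply, Finset.prod_mul_distrib]
  ring

variable [Nonempty X]

/-- The latent MDP of the lock with secret `σ`. -/
noncomputable def lockLMDP (F : HiddenGroups δ (N + 1) (N + 1) O X) (e : Fin (N + 1) × X ↪ Fin L)
    (σ : ℕ → Option (Fin A)) : LMDP (Option (Fin (N + 1)) × O) (Fin A) L (N + 1) :=
  LMDP.ofEmbedding e (fun y => lockMDP N σ y.1 (F.law y.2)) F.weight (lockReward A N O)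

/-- Indistinguishability replaces the mixture of group i by that of group 0, so the emission factor
leaves the sum over groups and the secret enters only through `lockWeight`. -/
theorem trajProb_lockLMDP (F : HiddenGroups δ (N + 1) (N + 1) O X) (e : Fin (N + 1) × X ↪ Fin L)
    (σ : ℕ → Option (Fin A)) (π : Policy (Option (Fin (N + 1)) × O) (Fin A) (N + 1))
    (τ : Trajectory (Option (Fin (N + 1)) × O) (Fin A) (N + 1)) :
    (F.lockLMDP e σ).trajProb π τ =
      ((N : ℝ) + 1)⁻¹ * lockWeight N σ (fun k => (τ k).2) (fun k => (τ k).1.1) *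
        F.emissionProb (fun k => (τ k).1.2) * ∏ h, π h (pastOf τ h) (τ h).1 (τ h).2 := by
  rw [lockLMDP, LMDP.trajProb_ofEmbedding]
  congr 1
  have hw : ∀ y, F.weight y = ((N : ℝ) + 1)⁻¹ * F.mixture y.1 y.2 := fun _ => rfl
  simp only [hw, prod_stepProb_lockMDP, Fintype.sum_prod_type]
  rw [lockWeight, Finset.mul_sum, Finset.sum_mul]
  refine Finset.sum_congr rfl fun i _ => ?_
  rw [emissionProb, F.indistinguishable 0 i, Finset.mul_sum]
  refine Finset.sum_congr rfl fun x _ => ?_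
  ring

/-- Two distinct instances of positive weight have distinct parameters, since a shared one would
force equal groups by `disjoint`. The emission coordinate alone then separates them at every state
and action. -/
theorem stronglySeparated_lockLMDP (F : HiddenGroups δ (N + 1) (N + 1) O X)
    (e : Fin (N + 1) × X ↪ Fin L) (σ : ℕ → Option (Fin A)) :
    (F.lockLMDP e σ).StronglySeparated δ := by
  refine LMDP.stronglySeparated_ofEmbedding _ _ _ _ fun y z hy hz hyz s a => ?_
  have hw : ∀ y, F.weight y = ((N : ℝ) + 1)⁻¹ * F.mixture y.1 y.2 := fun _ => rfl
  rw [hw] at hy hz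
  refine (F.separated y.2 z.2 fun h => hyz ?_).trans (tvDist_le_emitAt _ _ _ _)
  refine Prod.ext (F.disjoint _ _ y.2 (right_ne_zero_of_mul hy) ?_) h
  rw [h]
  exact right_ne_zero_of_mul hz

-- Reward requires the last level, reached by one of the N + 1 equally likely groups and only if the
-- lock is opened; there the trajectory law is `aliveProb` divided by N + 1.
open Classical in
theorem value_lockLMDP (F : HiddenGroups δ (N + 1) (N + 1) O X) (hN : 0 < N)
    (e : Fin (N + 1) × X ↪ Fin L) (σ : ℕ → Option (Fin A))
    (π : Policy (Option (Fin (N + 1)) × O) (Fin A) (N + 1)) :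
    (F.lockLMDP e σ).value π = ((N : ℝ) + 1)⁻¹ *
      ∑ τ, if lockOpened N σ (fun k => (τ k).2) then F.aliveProb π τ else 0 := by
  rw [LMDP.value, Finset.mul_sum]
  refine Finset.sum_congr rfl fun τ _ => ?_
  have hR : (F.lockLMDP e σ).reward = lockReward A N O := rfl
  rw [hR, sum_lockReward, trajProb_lockLMDP]
  by_cases hv : (τ (Fin.last N)).1.1 = some (Fin.last N)
  · rw [if_pos hv, lockWeight_of_last hN σ _ _ hv, aliveProb]
    split_ifs <;> ring
  · rw [if_neg hv, mul_zero, aliveProb, Finset.prod_eq_zero (Finset.mem_univ (Fin.last N))]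
    · simp
    · simp [hv]

theorem bddAbove_value_lockLMDP (F : HiddenGroups δ (N + 1) (N + 1) O X) (hN : 0 < N)
    (e : Fin (N + 1) × X ↪ Fin L) (σ : ℕ → Option (Fin A)) :
    BddAbove (Set.range (F.lockLMDP e σ).value) := by
  refine ⟨((N : ℝ) + 1)⁻¹, ?_⟩
  rintro _ ⟨π, rfl⟩
  rw [F.value_lockLMDP hN]
  refine mul_le_of_le_one_right (by positivity) ?_
  rw [← F.sum_aliveProb π]
  refine Finset.sum_le_sum fun τ _ => ?_
  split_ifs
  · exact le_rfl
  · exact F.aliveProb_nonneg π τ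

/-- The secret that accepts exactly the actions `s`. -/
def secretOf (s : Fin N → Fin A) : ℕ → Option (Fin A) :=
  fun k => if h : k < N then some (s ⟨k, h⟩) else none

theorem lockOpened_secretOf (s : Fin N → Fin A) (a : Fin (N + 1) → Fin A) :
    lockOpened N (secretOf s) a ↔ s = fun k => a k.castSucc := by
  constructor
  · intro h
    funext k
    have := h k.castSucc k.2
    simpa [secretOf] using this
  · rintro rfl h hh
    simp [secretOf, hh]

theorem le_optValue_lockLMDP (F : HiddenGroups δ (N + 1) (N + 1) O X) (hN : 0 < N)
    (e : Fin (N + 1) × X ↪ Fin L) (s : Fin N → Fin A) :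
    ((N : ℝ) + 1)⁻¹ ≤ (F.lockLMDP e (secretOf s)).optValue := by
  classical
  -- The action of the last step is irrelevant, so any default works.
  let a : Fin (N + 1) → Fin A := fun h => if hh : (h : ℕ) < N then s ⟨h, hh⟩ else s ⟨0, hN⟩
  let π : Policy (Option (Fin (N + 1)) × O) (Fin A) (N + 1) :=
    fun h _ _ => ⟨Pi.single (a h) 1, single_mem_stdSimplex ℝ (a h)⟩
  refine le_trans ?_ (le_ciSup (F.bddAbove_value_lockLMDP hN e _) π)
  rw [F.value_lockLMDP hN]
  refine (mul_one _).symm.le.trans (mul_le_mul_of_nonneg_left ?_ (by positivity))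
  rw [← F.sum_aliveProb π]
  refine Finset.sum_le_sum fun τ _ => ?_
  split_ifs with ho
  · exact le_rfl
  · have : ∃ h, (τ h).2 ≠ a h := by
      by_contra! hc
      apply ho
      rw [lockOpened_secretOf]
      funext k
      simp [hc, a]
    obtain ⟨h, hh⟩ := this
    have hz : ∏ h, π h (pastOf τ h) (τ h).1 (τ h).2 = 0 :=
      Finset.prod_eq_zero (Finset.mem_univ h) (Pi.single_eq_of_ne hh 1)
    rw [aliveProb, hz, mul_zero]

/-- A policy is near-optimal for at most one secret. -/
theorem eq_of_isNearOptimal (F : HiddenGroups δ (N + 1) (N + 1) O X) (hN : 0 < N)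
    (e : Fin (N + 1) × X ↪ Fin L) {s s' : Fin N → Fin A}
    {π : Policy (Option (Fin (N + 1)) × O) (Fin A) (N + 1)}
    (h : (F.lockLMDP e (secretOf s)).IsNearOptimal (1 / (4 * ((N : ℝ) + 1))) π)
    (h' : (F.lockLMDP e (secretOf s')).IsNearOptimal (1 / (4 * ((N : ℝ) + 1))) π) : s = s' := by
  classical
  by_contra hne
  have h1 := F.le_optValue_lockLMDP hN e s
  have h2 := F.le_optValue_lockLMDP hN e s'
  unfold LMDP.IsNearOptimal at h h'
  rw [F.value_lockLMDP hN] at h h'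
  -- One action sequence opens at most one of the two locks, whereas near-optimality for both would
  -- make each opening probability at least 3/4.
  have h3 : (∑ τ, if lockOpened N (secretOf s) (fun k => (τ k).2) then F.aliveProb π τ else 0) +
      (∑ τ, if lockOpened N (secretOf s') (fun k => (τ k).2) then F.aliveProb π τ else 0) ≤ 1 := by
    rw [← Finset.sum_add_distrib, ← F.sum_aliveProb π]
    refine Finset.sum_le_sum fun τ _ => ?_
    have := F.aliveProb_nonneg π τ
    split_ifs with h4 h5
    · rw [lockOpened_secretOf] at h4 h5
      exact absurd (h4.trans h5.symm) hne
    all_goals simp [this]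
  have hpos : (0 : ℝ) < ((N : ℝ) + 1)⁻¹ := by positivity
  have h4 : 1 / (4 * ((N : ℝ) + 1)) = ((N : ℝ) + 1)⁻¹ / 4 := by
    field_simp
  have h5 := mul_le_mul_of_nonneg_left h3 hpos.le
  rw [mul_add, mul_one] at h5
  linarith

theorem trajProb_lockLMDP_congr (F : HiddenGroups δ (N + 1) (N + 1) O X) (hN : 0 < N)
    (e : Fin (N + 1) × X ↪ Fin L) {σ σ' : ℕ → Option (Fin A)}
    (π : Policy (Option (Fin (N + 1)) × O) (Fin A) (N + 1))
    (τ : Trajectory (Option (Fin (N + 1)) × O) (Fin A) (N + 1))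
    (h : ¬ lockOpened N σ fun k => (τ k).2) (h' : ¬ lockOpened N σ' fun k => (τ k).2) :
    (F.lockLMDP e σ).trajProb π τ = (F.lockLMDP e σ').trajProb π τ := by
  rw [trajProb_lockLMDP, trajProb_lockLMDP, lockWeight_congr hN h h']

/-- Learning all the locks takes a number of episodes proportional to the number of secrets. -/
theorem pow_le_of_successProb (F : HiddenGroups δ (N + 1) (N + 1) O X) (hN : 0 < N)
    (e : Fin (N + 1) × X ↪ Fin L) {T : ℕ} {Ω : Type} [MeasurableSpace Ω] (P : Measure Ω)
    [IsProbabilityMeasure P]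
    (alg : LearningAlg Ω (Option (Fin (N + 1)) × O) (Fin A) (N + 1) T)
    (halg : ∀ s : Fin N → Fin A,
      3 / 4 ≤ alg.successProb P (F.lockLMDP e (secretOf s)) (1 / (4 * ((N : ℝ) + 1)))) :
    3 / 4 * (A : ℝ) ^ N ≤ 1 + T := by
  classical
  -- A non-integrable function would have integral zero, contradicting success probability 3/4.
  have hintegrable : ∀ s : Fin N → Fin A, Integrable (fun ω => ∑ D, if
      (F.lockLMDP e (secretOf s)).IsNearOptimal (1 / (4 * ((N : ℝ) + 1))) (alg.output D ω)
      then alg.dataProb (F.lockLMDP e (secretOf s)) ω D else 0) P := by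
    intro s
    by_contra hc
    have h1 := halg s
    rw [LearningAlg.successProb, integral_undef hc] at h1
    norm_num at h1
  -- The reference law comes from the lock with no correct action at any level.
  have hnull : ∀ a : Fin (N + 1) → Fin A, ¬ lockOpened N (fun _ => none) a := fun a h => by
    simpa using h ⟨0, by omega⟩ hN
  calc 3 / 4 * (A : ℝ) ^ N = ∑ _s : Fin N → Fin A, (3 / 4 : ℝ) := by
        simp [mul_comm]
    _ ≤ ∑ s : Fin N → Fin A,
          alg.successProb P (F.lockLMDP e (secretOf s)) (1 / (4 * ((N : ℝ) + 1))) :=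
        Finset.sum_le_sum fun s _ => halg s
    _ = ∫ ω, ∑ s : Fin N → Fin A, ∑ D, (if
          (F.lockLMDP e (secretOf s)).IsNearOptimal (1 / (4 * ((N : ℝ) + 1))) (alg.output D ω)
          then alg.dataProb (F.lockLMDP e (secretOf s)) ω D else 0) ∂P :=
        (integral_finsetSum _ fun s _ => hintegrable s).symm
    _ ≤ ∫ _ω, (1 + T : ℝ) ∂P := by
        refine integral_mono (integrable_finsetSum _ fun s _ => hintegrable s) (integrable_const _)
          fun ω => ?_
        refine sum_event_le_one_add _
          (fun s D => ∃ t, lockOpened N (secretOf s) fun k => (D t k).2)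
          (fun s D => alg.dataProb (F.lockLMDP e (secretOf s)) ω D)
          (fun D => alg.dataProb (F.lockLMDP e fun _ => none) ω D)
          (fun _ _ => alg.dataProb_nonneg _ _ _) (fun _ => alg.dataProb_nonneg _ _ _)
          (fun _ => alg.sum_dataProb _ _) (alg.sum_dataProb _ _) ?_ ?_ ?_
        · intro s D hD
          push Not at hD
          exact Finset.prod_congr rfl fun t _ =>
            F.trajProb_lockLMDP_congr hN e _ _ (hD t) (hnull _)
        · exact fun D s s' h h' => F.eq_of_isNearOptimal hN e h h'
        · intro D
          have hsub : (Finset.univ.filter fun s : Fin N → Fin A =>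
              ∃ t, lockOpened N (secretOf s) fun k => (D t k).2) ⊆
              Finset.univ.image fun (t : Fin T) (k : Fin N) => (D t k.castSucc).2 := by
            intro s hs
            obtain ⟨t, ht⟩ := (Finset.mem_filter.1 hs).2
            rw [lockOpened_secretOf] at ht
            exact Finset.mem_image.2 ⟨t, Finset.mem_univ _, ht.symm⟩
          exact (Finset.card_le_card hsub).trans (Finset.card_image_le.trans (by simp))
    _ = 1 + T := by simp

end HiddenGroups

/-! ### Two mixtures with the same moments -/

/-- With more laws than moments of order `H`, two mixtures of disjoint sets of laws have the same
moments of order `H`. -/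
theorem exists_indistinguishable_mixtures {O X : Type} [Fintype O] [Fintype X] (H : ℕ)
    (law : X → stdSimplex ℝ O)
    (hcard : (Fintype.card O + H - 1).choose H < Fintype.card X) :
    ∃ ξ : Bool → stdSimplex ℝ X,
      (∀ (b c : Bool) (o : Fin H → O),
        ∑ x, ξ b x * ∏ h, law x (o h) = ∑ x, ξ c x * ∏ h, law x (o h)) ∧
      ∀ (b c : Bool) (x : X), ξ b x ≠ 0 → ξ c x ≠ 0 → b = c := by
  classical
  -- A product of H masses depends only on the multiset of symbols, so there are as many moments as
  -- multisets of size H, fewer than laws.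
  let M : Matrix (Sym O H) X ℝ := fun m x => ((m : Multiset O).map fun y => law x y).prod
  have hker : LinearMap.ker M.mulVecLin ≠ ⊥ := by
    refine LinearMap.ker_ne_bot_of_finrank_lt ?_
    rw [Module.finrank_fintype_fun_eq_card, Module.finrank_fintype_fun_eq_card,
      Sym.card_sym_eq_choose]
    exact hcard
  obtain ⟨η, hη, hη0⟩ := (Submodule.ne_bot_iff _).1 hker
  have hmom : ∀ o : Fin H → O, ∑ x, η x * ∏ h, law x (o h) = 0 := by
    intro o
    have hm : (Finset.univ.val.map o).card = H := by simp
    have h1 : M.mulVecLin η (Sym.mk (Finset.univ.val.map o) hm) = 0 := by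
      rw [LinearMap.mem_ker.1 hη]
      rfl
    rw [Matrix.mulVecLin_apply] at h1
    rw [← h1]
    refine Finset.sum_congr rfl fun x _ => ?_
    rw [mul_comm]
    congr 1
    change _ = ((Finset.univ.val.map o).map fun y => law x y).prod
    rw [Multiset.map_map]
    rfl
  -- Adding the vanishing moments over all sequences leaves the total mass of η.
  have hsum : ∑ x, η x = 0 := by
    have h1 : ∀ x, ∑ o : Fin H → O, ∏ h, law x (o h) = 1 := by
      intro x
      have := Finset.prod_univ_sum (fun _ : Fin H => (Finset.univ : Finset O)) fun _ y => law x y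
      rw [Fintype.piFinset_univ] at this
      rw [← this]
      simp
    calc ∑ x, η x = ∑ x, η x * ∑ o : Fin H → O, ∏ h, law x (o h) := by simp [h1]
      _ = ∑ o : Fin H → O, ∑ x, η x * ∏ h, law x (o h) := by
          simp only [Finset.mul_sum]
          rw [Finset.sum_comm]
      _ = 0 := by simp [hmom]
  set Z : ℝ := ∑ x, (η x)⁺ with hZ
  have hsub : ∀ f : X → ℝ, ∑ x, η x * f x = ∑ x, (η x)⁺ * f x - ∑ x, (η x)⁻ * f x := by
    intro f
    rw [← Finset.sum_sub_distrib]
    refine Finset.sum_congr rfl fun x _ => ?_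
    rw [← sub_mul, posPart_sub_negPart]
  have hZ' : ∑ x, (η x)⁻ = Z := by
    have := hsub fun _ => 1
    simp only [mul_one, hsum] at this
    linarith
  have hZpos : 0 < Z := by
    obtain ⟨x, hx⟩ := Function.ne_iff.1 hη0
    rcases lt_or_gt_of_ne hx with h | h
    · rw [← hZ']
      exact Finset.sum_pos' (fun x _ => negPart_nonneg _)
        ⟨x, Finset.mem_univ _, negPart_pos_iff.2 h⟩
    · exact Finset.sum_pos' (fun x _ => posPart_nonneg _)
        ⟨x, Finset.mem_univ _, posPart_pos_iff.2 h⟩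
  let part : Bool → X → ℝ := fun b x => bif b then (η x)⁺ else (η x)⁻
  have hpart : ∀ b x, 0 ≤ part b x := by
    rintro (_ | _) x
    · exact negPart_nonneg _
    · exact posPart_nonneg _
  have hpsum : ∀ b, ∑ x, part b x = Z := by
    rintro (_ | _)
    · exact hZ'
    · rfl
  refine ⟨fun b => ⟨fun x => part b x / Z, fun x => div_nonneg (hpart b x) hZpos.le, ?_⟩, ?_, ?_⟩
  · rw [← Finset.sum_div, hpsum, div_self hZpos.ne']
  · have hb : ∀ (b : Bool) (o : Fin H → O), ∑ x, part b x / Z * ∏ h, law x (o h) =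
        (∑ x, (η x)⁺ * ∏ h, law x (o h)) / Z := by
      intro b o
      have h2 : ∑ x, part b x * ∏ h, law x (o h) = ∑ x, (η x)⁺ * ∏ h, law x (o h) := by
        cases b
        · have := hsub fun x => ∏ h, law x (o h)
          rw [hmom] at this
          exact (sub_eq_zero.1 this.symm).symm
        · rfl
      rw [← h2, Finset.sum_div]
      exact Finset.sum_congr rfl fun x _ => by ring
    intro b c o
    exact (hb b o).trans (hb c o).symm
  · have hne : ∀ x, part true x / Z ≠ 0 → part false x / Z ≠ 0 → False := by
      intro x h1 h2
      rcases le_total (η x) 0 with h | h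
      · exact h1 (by simp [part, posPart_eq_zero.2 h])
      · exact h2 (by simp [part, negPart_eq_zero.2 h])
    rintro (_ | _) (_ | _) x h1 h2
    · rfl
    · exact (hne x h2 h1).elim
    · exact (hne x h1 h2).elim
    · rfl

/-! ### Products of mixtures -/

/-- The product of finitely many probability vectors. -/
noncomputable def piVector {r : ℕ} {O : Type} [Fintype O] (p : Fin r → stdSimplex ℝ O) :
    stdSimplex ℝ (Fin r → O) :=
  ⟨fun o => ∏ j, p j (o j), fun _ => Finset.prod_nonneg fun _ _ => stdSimplex.zero_le _ _, by
    classical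
    have := Finset.prod_univ_sum (fun _ : Fin r => (Finset.univ : Finset O)) fun j y => p j y
    rw [Fintype.piFinset_univ] at this
    rw [← this]
    simp⟩

theorem piVector_apply {r : ℕ} {O : Type} [Fintype O] (p : Fin r → stdSimplex ℝ O)
    (o : Fin r → O) : piVector p o = ∏ j, p j (o j) := rfl

theorem sum_prod_pi {r : ℕ} {O : Type} [Fintype O] (f : Fin r → O → ℝ) :
    ∑ o : Fin r → O, ∏ j, f j (o j) = ∏ j, ∑ y, f j y := by
  classical
  rw [Finset.prod_univ_sum, Fintype.piFinset_univ]

theorem piVector_marginal {r : ℕ} {O : Type} [Fintype O] [DecidableEq O]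
    (p : Fin r → stdSimplex ℝ O) (j : Fin r) (y : O) :
    p j y = ∑ o : Fin r → O, if o j = y then piVector p o else 0 := by
  -- The constraint on coordinate j is absorbed into its factor, so that the sum factorizes.
  have h : ∀ o : Fin r → O, (if o j = y then piVector p o else 0) =
      ∏ k, (if k = j then (if o k = y then p k (o k) else 0) else p k (o k)) := by
    intro o
    split_ifs with ho
    · rw [piVector_apply]
      refine Finset.prod_congr rfl fun k _ => ?_
      split_ifs with hk hk'
      · rfl
      · exact absurd (hk ▸ ho) hk'
      · rfl
    · rw [Finset.prod_eq_zero (Finset.mem_univ j)]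
      simp [ho]
  simp only [h]
  rw [sum_prod_pi fun k z => if k = j then (if z = y then p k z else 0) else p k z,
    Finset.prod_eq_single j]
  · simp
  · intro k _ hk
    simp [hk]
  · simp

/-- Mixtures indexed by the binary digits of the group. -/
noncomputable def HiddenGroups.ofBits {δ : ℝ} {H G r : ℕ} {O X : Type} [Fintype O] [Fintype X]
    (hG : G ≤ 2 ^ r) (law : X → stdSimplex ℝ O) (ξ : Bool → stdSimplex ℝ X)
    (hind : ∀ (b c : Bool) (o : Fin H → O),
      ∑ x, ξ b x * ∏ h, law x (o h) = ∑ x, ξ c x * ∏ h, law x (o h))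
    (hdisj : ∀ (b c : Bool) (x : X), ξ b x ≠ 0 → ξ c x ≠ 0 → b = c)
    (hsep : ∀ x y : X, x ≠ y → δ ≤ tvDist (law x) (law y)) :
    HiddenGroups δ H G (Fin r → O) (Fin r → X) where
  law x := piVector fun j => law (x j)
  mixture i := piVector fun j => ξ (Nat.testBit i j)
  indistinguishable i j o := by
    have key : ∀ i : Fin G, ∑ x : Fin r → X, (piVector fun j => ξ (Nat.testBit i j)) x *
        ∏ h, (piVector fun j => law (x j)) (o h) =
          ∏ j : Fin r, ∑ x, ξ true x * ∏ h, law x (o h j) := by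
      intro i
      simp only [piVector_apply]
      have h1 : ∀ x : Fin r → X, (∏ j : Fin r, ξ (Nat.testBit i j) (x j)) *
          ∏ h, ∏ j, law (x j) (o h j) =
            ∏ j : Fin r, (ξ (Nat.testBit i j) (x j) * ∏ h, law (x j) (o h j)) := by
        intro x
        rw [Finset.prod_comm, ← Finset.prod_mul_distrib]
      simp only [h1]
      rw [sum_prod_pi fun (j : Fin r) x => ξ (Nat.testBit i j) x * ∏ h, law x (o h j)]
      exact Finset.prod_congr rfl fun j _ => hind _ _ _
    rw [key, key]
  disjoint i j x hi hj := by
    rw [piVector_apply, Finset.prod_ne_zero_iff] at hi hj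
    refine Fin.ext (Nat.eq_of_testBit_eq fun k => ?_)
    by_cases hk : k < r
    · exact hdisj _ _ (x ⟨k, hk⟩) (hi ⟨k, hk⟩ (Finset.mem_univ _)) (hj ⟨k, hk⟩ (Finset.mem_univ _))
    -- Digits beyond the first r vanish for both groups.
    · have hpow : 2 ^ r ≤ 2 ^ k := Nat.pow_le_pow_right (by norm_num) (not_lt.1 hk)
      rw [Nat.testBit_lt_two_pow (i.2.trans_le (hG.trans hpow)),
        Nat.testBit_lt_two_pow (j.2.trans_le (hG.trans hpow))]
  separated x y hxy := by
    classical
    obtain ⟨j, hj⟩ := Function.ne_iff.1 hxy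
    exact (hsep _ _ hj).trans (tvDist_le_of_marginal (fun o => o j) _ _ _ _
      (piVector_marginal (fun j => law (x j)) j) (piVector_marginal (fun j => law (y j)) j))

/-! ### A separated set of laws -/

/-- The law on `n + 1` symbols with masses `x i / (q n)` on the first `n` of them. -/
noncomputable def gridLaw {n q : ℕ} (x : Fin n → Fin q) : stdSimplex ℝ (Option (Fin n)) :=
  ⟨fun y => y.elim (1 - ∑ i, (x i : ℝ) / (q * n)) fun i => (x i : ℝ) / (q * n), by
    constructor
    · rintro (_ | i)
      · have : ∀ i, (x i : ℝ) / (q * n) ≤ 1 / n := by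
          intro i
          have hq : (0 : ℝ) < q := by exact_mod_cast (x i).pos
          have hx : (x i : ℝ) ≤ q := by exact_mod_cast (x i).2.le
          have hn : (0 : ℝ) < n := by exact_mod_cast i.pos
          rw [div_le_div_iff₀ (by positivity) hn]
          nlinarith
        have h2 : ∑ i, (x i : ℝ) / (q * n) ≤ ∑ _i : Fin n, (1 : ℝ) / n :=
          Finset.sum_le_sum fun i _ => this i
        have h3 : ∑ _i : Fin n, (1 : ℝ) / n ≤ 1 := by
          simp only [Finset.sum_const, Finset.card_univ, Fintype.card_fin, nsmul_eq_mul, one_div]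
          exact mul_inv_le_one
        simp only [Option.elim]
        linarith
      · simp only [Option.elim]
        positivity
    · rw [Fintype.sum_option]
      simp⟩

/-- The `ℓ¹` distance on the grid. -/
def gridDist {n q : ℕ} (x y : Fin n → Fin q) : ℕ := ∑ i, ((x i : ℤ) - y i).natAbs

theorem le_tvDist_gridLaw {n q : ℕ} (hn : 0 < n) (x y : Fin n → Fin q) (h : n ≤ gridDist x y) :
    1 / (2 * (q : ℝ)) ≤ tvDist (gridLaw x) (gridLaw y) := by
  have hq : (0 : ℝ) < q := by exact_mod_cast (x ⟨0, hn⟩).pos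
  have hn' : (0 : ℝ) < n := by exact_mod_cast hn
  rw [tvDist, Fintype.sum_option]
  have h1 : ∀ i, |gridLaw x (some i) - gridLaw y (some i)| =
      (((x i : ℤ) - y i).natAbs : ℝ) / (q * n) := by
    intro i
    change |(x i : ℝ) / (q * n) - (y i : ℝ) / (q * n)| = _
    rw [← sub_div, abs_div, abs_of_pos (mul_pos hq hn'), Nat.cast_natAbs]
    push_cast
    rfl
  simp only [h1]
  rw [← Finset.sum_div, ← Nat.cast_sum]
  have h2 : (1 : ℝ) / q ≤ ((gridDist x y : ℕ) : ℝ) / (q * n) := by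
    rw [div_le_div_iff₀ hq (by positivity)]
    have : (n : ℝ) ≤ gridDist x y := by exact_mod_cast h
    nlinarith
  have h3 : (1 : ℝ) / (2 * q) = 1 / 2 * (1 / q) := by field_simp
  rw [h3]
  refine mul_le_mul_of_nonneg_left (h2.trans (le_add_of_nonneg_left (abs_nonneg _))) (by norm_num)

/-- Two geometric series: the terms up to b contribute at most 2, those beyond at most 1. -/
theorem sum_half_pow_dist_le (q b : ℕ) :
    ∑ a ∈ Finset.range q, (1 / 2 : ℝ) ^ ((a : ℤ) - b).natAbs ≤ 3 := by
  have h1 : ∀ q ≤ b + 1, ∑ a ∈ Finset.range q, (1 / 2 : ℝ) ^ ((a : ℤ) - b).natAbs ≤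
      2 * (1 / 2) ^ (b + 1 - q) := by
    intro q hq
    induction q with
    | zero => simp
    | succ q ih =>
      rw [Finset.sum_range_succ]
      have h2 := ih (by omega)
      have e1 : ((q : ℤ) - b).natAbs = b - q := by omega
      have e2 : b + 1 - (q + 1) = b - q := by omega
      have e3 : b + 1 - q = (b - q) + 1 := by omega
      rw [e3, pow_succ] at h2
      rw [e1, e2]
      linarith
  have h2 : ∀ j : ℕ, ∑ a ∈ Finset.range (b + 1 + j), (1 / 2 : ℝ) ^ ((a : ℤ) - b).natAbs ≤
      3 - (1 / 2) ^ j := by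
    intro j
    induction j with
    | zero =>
      refine (h1 (b + 1) le_rfl).trans ?_
      norm_num
    | succ j ih =>
      rw [← add_assoc, Finset.sum_range_succ]
      have e1 : (((b + 1 + j : ℕ) : ℤ) - b).natAbs = j + 1 := by omega
      rw [e1, pow_succ]
      linarith
  refine (Finset.sum_le_sum_of_subset_of_nonneg (t := Finset.range (b + 1 + q))
    (Finset.range_mono (by omega)) fun _ _ _ => by positivity).trans ((h2 q).trans ?_)
  have : (0 : ℝ) ≤ (1 / 2) ^ q := by positivity
  linarith

/-- An exponential-moment bound: the weights 2^(-dist) factorize over coordinates and total at most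
3^n, while each point of the ball weighs at least 2^(-n). -/
theorem card_gridBall_le {n q : ℕ} (y : Fin n → Fin q) :
    (Finset.univ.filter fun x : Fin n → Fin q => gridDist x y ≤ n).card ≤ 6 ^ n := by
  classical
  have h1 : ∑ x : Fin n → Fin q, (1 / 2 : ℝ) ^ gridDist x y ≤ 3 ^ n := by
    have h : ∀ x : Fin n → Fin q, (1 / 2 : ℝ) ^ gridDist x y =
        ∏ i, (1 / 2 : ℝ) ^ ((x i : ℤ) - y i).natAbs := fun x =>
      (Finset.prod_pow_eq_pow_sum _ _ _).symm
    simp only [h]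
    rw [sum_prod_pi fun i (a : Fin q) => (1 / 2 : ℝ) ^ ((a : ℤ) - y i).natAbs]
    calc ∏ i, ∑ a : Fin q, (1 / 2 : ℝ) ^ ((a : ℤ) - y i).natAbs ≤ ∏ _i : Fin n, (3 : ℝ) := by
          refine Finset.prod_le_prod (fun _ _ => Finset.sum_nonneg fun _ _ => by positivity)
            fun i _ => ?_
          rw [← Finset.sum_range fun a => (1 / 2 : ℝ) ^ ((a : ℤ) - y i).natAbs]
          exact sum_half_pow_dist_le q (y i)
      _ = 3 ^ n := by simp
  have h2 : ((Finset.univ.filter fun x : Fin n → Fin q => gridDist x y ≤ n).card : ℝ) *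
      (1 / 2) ^ n ≤ 3 ^ n := by
    refine le_trans ?_ h1
    rw [← nsmul_eq_mul, ← Finset.sum_const]
    refine (Finset.sum_le_sum fun x hx => ?_).trans
      (Finset.sum_le_sum_of_subset_of_nonneg (Finset.filter_subset _ _) fun _ _ _ => by positivity)
    exact pow_le_pow_of_le_one (by norm_num) (by norm_num) (Finset.mem_filter.1 hx).2
  have h3 : (6 : ℝ) ^ n = 3 ^ n * 2 ^ n := by rw [← mul_pow]; norm_num
  have h4 : ((1 : ℝ) / 2) ^ n * 2 ^ n = 1 := by rw [← mul_pow]; norm_num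
  have h5 := mul_le_mul_of_nonneg_right h2 (pow_nonneg (by norm_num : (0 : ℝ) ≤ 2) n)
  rw [mul_assoc, h4, mul_one, ← h3] at h5
  exact_mod_cast h5

theorem gridDist_comm {n q : ℕ} (x y : Fin n → Fin q) : gridDist x y = gridDist y x :=
  Finset.sum_congr rfl fun i _ => by omega

/-- The balls of radius n around a packing of maximal cardinality cover the grid. -/
theorem exists_grid_packing (n q : ℕ) :
    ∃ X : Finset (Fin n → Fin q), (∀ x ∈ X, ∀ y ∈ X, x ≠ y → n ≤ gridDist x y) ∧
      q ^ n ≤ X.card * 6 ^ n := by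
  classical
  let good : Finset (Finset (Fin n → Fin q)) :=
    Finset.univ.filter fun X => ∀ x ∈ X, ∀ y ∈ X, x ≠ y → n ≤ gridDist x y
  obtain ⟨X, hX, hmax⟩ := good.exists_max_image Finset.card ⟨∅, by simp [good]⟩
  have hX' := (Finset.mem_filter.1 hX).2
  refine ⟨X, hX', ?_⟩
  have hcover : (Finset.univ : Finset (Fin n → Fin q)) ⊆
      X.biUnion fun y => Finset.univ.filter fun x => gridDist x y ≤ n := by
    intro x _
    by_contra hx
    simp only [Finset.mem_biUnion, Finset.mem_filter, Finset.mem_univ, true_and, not_exists,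
      not_and, not_le] at hx
    have hxX : x ∉ X := fun h => by
      have := hx x h
      simp [gridDist] at this
    have hins : insert x X ∈ good := by
      refine Finset.mem_filter.2 ⟨Finset.mem_univ _, fun u hu v hv huv => ?_⟩
      rw [Finset.mem_insert] at hu hv
      rcases hu with rfl | hu <;> rcases hv with rfl | hv
      · exact absurd rfl huv
      · exact (hx v hv).le
      · rw [gridDist_comm]
        exact (hx u hu).le
      · exact hX' u hu v hv huv
    have := hmax _ hins
    rw [Finset.card_insert_of_notMem hxX] at this
    omega
  calc q ^ n = (Finset.univ : Finset (Fin n → Fin q)).card := by simp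
    _ ≤ _ := Finset.card_le_card hcover
    _ ≤ ∑ y ∈ X, (Finset.univ.filter fun x => gridDist x y ≤ n).card := Finset.card_biUnion_le
    _ ≤ ∑ _y ∈ X, 6 ^ n := Finset.sum_le_sum fun y _ => card_gridBall_le y
    _ = X.card * 6 ^ n := by simp

/-- The packing must outnumber the moments of order H on n + 1 symbols. One term of the binomial
expansion of (t + 7/q)^(n + H) = 1, with t = 1 - 7/q, bounds the binomial coefficient. The loss t^H
is beaten by (7/6)^n because t ≥ exp(-14/q), 7/6 ≥ exp(1/7) and 14 H/q < n/7. -/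
theorem choose_lt_of_pow_le {n q H c : ℕ} (hq : 14 ≤ q) (hH : 98 * H < n * q)
    (hc : q ^ n ≤ c * 6 ^ n) : (n + H).choose H < c := by
  have hq' : (14 : ℝ) ≤ q := by exact_mod_cast hq
  have hq0 : (0 : ℝ) < q := by linarith
  set t : ℝ := 1 - 7 / q with ht
  have h7 : 7 / (q : ℝ) ≤ 1 / 2 := by
    rw [div_le_div_iff₀ hq0 (by norm_num)]
    linarith
  have ht0 : 0 < t := by linarith
  have hbin : t ^ H * (7 / q : ℝ) ^ n * ((n + H).choose H : ℝ) ≤ 1 := by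
    have h1 : (1 : ℝ) = (t + 7 / q) ^ (n + H) := by rw [ht]; simp
    rw [h1, add_pow]
    refine le_trans (le_of_eq ?_) (Finset.single_le_sum (f := fun m =>
      t ^ m * (7 / q : ℝ) ^ (n + H - m) * ((n + H).choose m : ℝ)) (fun m _ => by positivity)
      (Finset.mem_range.2 (by omega : H < n + H + 1)))
    simp
  have hexp : 1 < t ^ H * (7 / 6 : ℝ) ^ n := by
    have e1 : Real.exp (-(14 / q)) ≤ t := by
      have h1 : 1 + 14 / (q : ℝ) ≤ Real.exp (14 / q) := by
        linarith [Real.add_one_le_exp (14 / (q : ℝ))]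
      rw [Real.exp_neg]
      refine (inv_anti₀ (by positivity) h1).trans ?_
      rw [inv_le_iff_one_le_mul₀ (by positivity), ht]
      have h2 : 14 / (q : ℝ) = 2 * (7 / q) := by ring
      rw [h2]
      have h3 : 0 < 7 / (q : ℝ) := by positivity
      nlinarith
    have e2 : Real.exp (1 / 7) ≤ 7 / 6 := by
      have h1 : 6 / 7 ≤ Real.exp (-(1 / 7)) := by linarith [Real.add_one_le_exp (-(1 / 7 : ℝ))]
      rw [Real.exp_neg] at h1
      have h2 := inv_anti₀ (by norm_num) h1
      rw [inv_inv] at h2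
      norm_num at h2 ⊢
      exact h2
    calc (1 : ℝ) < Real.exp (H * (-(14 / q)) + n * (1 / 7)) := by
          rw [Real.one_lt_exp_iff]
          have : (98 : ℝ) * H < n * q := by exact_mod_cast hH
          have h2 : (H : ℝ) * (-(14 / q)) + n * (1 / 7) = (n * q - 98 * H) / (7 * q) := by
            field_simp
            ring
          rw [h2]
          exact div_pos (by linarith) (by positivity)
      _ = Real.exp (-(14 / q)) ^ H * Real.exp (1 / 7) ^ n := by
          rw [Real.exp_add, Real.exp_nat_mul, Real.exp_nat_mul]
      _ ≤ t ^ H * (7 / 6 : ℝ) ^ n := by gcongr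
  by_contra! hle
  have hc' : (q : ℝ) ^ n ≤ c * 6 ^ n := by exact_mod_cast hc
  have hle' : (c : ℝ) ≤ (n + H).choose H := by exact_mod_cast hle
  have h1 : (7 / 6 : ℝ) ^ n ≤ (7 / q : ℝ) ^ n * c := by
    rw [div_pow, div_pow, div_mul_eq_mul_div, div_le_div_iff₀ (by positivity) (by positivity)]
    have : (0 : ℝ) ≤ 7 ^ n := by positivity
    nlinarith
  have h2 : t ^ H * (7 / 6 : ℝ) ^ n ≤ t ^ H * (7 / q : ℝ) ^ n * ((n + H).choose H : ℝ) := by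
    rw [mul_assoc]
    refine mul_le_mul_of_nonneg_left (h1.trans ?_) (by positivity)
    exact mul_le_mul_of_nonneg_left hle' (by positivity)
  linarith

/-- Groups that `H` emissions do not reveal, on `(n + 1) ^ r` symbols and with at most `q ^ (n r)`
parameters. -/
theorem exists_hiddenGroups {n q H G r : ℕ} (hn : 0 < n) (hq : 14 ≤ q) (hH : 98 * H < n * q)
    (hG : G ≤ 2 ^ r) {δ : ℝ} (hδ : δ ≤ 1 / (2 * (q : ℝ))) :
    ∃ (X : Type) (_ : Fintype X), Fintype.card X ≤ (q ^ n) ^ r ∧ Nonempty X ∧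
      Nonempty (HiddenGroups δ H G (Fin r → Option (Fin n)) X) := by
  obtain ⟨X, hX, hcard⟩ := exists_grid_packing n q
  have hch := choose_lt_of_pow_le hq hH hcard
  obtain ⟨ξ, h1, h2⟩ := exists_indistinguishable_mixtures (X := X) H (fun x => gridLaw x.1) (by
    rw [Fintype.card_coe, Fintype.card_option, Fintype.card_fin]
    convert hch using 2
    omega)
  refine ⟨Fin r → X, inferInstance, ?_, ?_,
    ⟨HiddenGroups.ofBits hG (fun x : X => gridLaw x.1) ξ h1 h2 fun x y hxy => ?_⟩⟩
  · rw [Fintype.card_fun, Fintype.card_fin, Fintype.card_coe]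
    refine Nat.pow_le_pow_left ?_ r
    simpa using X.card_le_univ
  · have : 0 < X.card := (Nat.zero_le _).trans_lt hch
    obtain ⟨x, hx⟩ := Finset.card_pos.1 this
    exact ⟨fun _ => ⟨x, hx⟩⟩
  · exact hδ.trans (le_tvDist_gridLaw hn _ _
      (hX x.1 x.2 y.1 y.2 fun h => hxy (Subtype.ext h)))

/-! ### Choice of the parameters -/

theorem clog_two_le_mul_log {H : ℕ} (hH : 3 ≤ H) : (Nat.clog 2 H : ℝ) ≤ 3 * Real.log H := by
  have hH' : (3 : ℝ) ≤ H := by exact_mod_cast hH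
  have hlog : 1 ≤ Real.log H := by
    rw [Real.le_log_iff_exp_le (by linarith)]
    linarith [Real.exp_one_lt_d9]
  have hr : 0 < Nat.clog 2 H := Nat.clog_pos (by norm_num) (by omega)
  have h1 : 2 ^ (Nat.clog 2 H - 1) < H := by
    simpa using Nat.pow_pred_clog_lt_self (b := 2) (by norm_num) (by omega : 1 < H)
  have h2 : (2 : ℝ) ^ (Nat.clog 2 H - 1) ≤ H := by exact_mod_cast h1.le
  have h3 := Real.log_le_log (by positivity) h2
  rw [Real.log_pow, Nat.cast_sub hr, Nat.cast_one] at h3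
  nlinarith [Real.log_two_gt_d9]

theorem state_count_le {H n r : ℕ} {Λ : ℝ} (hH : 3 ≤ H) (hΛ : 3 ≤ Λ) (hn : ((n + 1 : ℕ) : ℝ) ≤ Λ)
    (hr : (r : ℝ) ≤ 3 * Real.log H) :
    ((H + 1 : ℕ) : ℝ) * ((n + 1 : ℕ) : ℝ) ^ r ≤ Λ ^ (5 * Real.log (H : ℝ)) := by
  have hH' : (3 : ℝ) ≤ H := by exact_mod_cast hH
  have ha : 0 ≤ Real.log (H : ℝ) := Real.log_natCast_nonneg H
  have h2 : ((n + 1 : ℕ) : ℝ) ^ r ≤ Λ ^ (3 * Real.log (H : ℝ)) := by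
    refine (pow_le_pow_left₀ (by positivity) hn r).trans ?_
    rw [← Real.rpow_natCast]
    exact Real.rpow_le_rpow_of_exponent_le (by linarith) hr
  have h3 : ((H + 1 : ℕ) : ℝ) ≤ Λ ^ (2 * Real.log (H : ℝ)) := by
    have h4 : ((H + 1 : ℕ) : ℝ) ≤ (H : ℝ) ^ 2 := by
      push_cast
      nlinarith
    refine h4.trans ?_
    have h5 : (H : ℝ) ^ 2 = Real.exp 1 ^ (2 * Real.log (H : ℝ)) := by
      rw [← Real.exp_mul, one_mul, mul_comm, Real.exp_mul, Real.exp_log (by linarith)]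
      norm_cast
    rw [h5]
    exact Real.rpow_le_rpow (by positivity) (by linarith [Real.exp_one_lt_d9]) (by linarith)
  calc ((H + 1 : ℕ) : ℝ) * ((n + 1 : ℕ) : ℝ) ^ r
      ≤ Λ ^ (2 * Real.log (H : ℝ)) * Λ ^ (3 * Real.log (H : ℝ)) := by gcongr
    _ = Λ ^ (5 * Real.log (H : ℝ)) := by
        rw [← Real.rpow_add (by linarith)]
        congr 1
        ring

/-- Take q about 1/(2δ) for the separation, n about 400 δH so that n q ≥ 100 H, and r binary digits
to number H groups. The number of instances then has logarithm at most a + r n log q, of order (δH +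
1) log H log(1/δ), which the two hypotheses on L bound. -/
theorem lock_parameter_bounds {δ : ℝ} {H L : ℕ} (hδ : 0 < δ) (hδ' : δ ≤ 1 / (4 * Real.exp 1 ^ 2))
    (hH : 3 ≤ H) (hL : (2 : ℝ) ^ (2500 * Real.log (1 / δ) ^ 2) ≤ (L : ℝ))
    (hHL : 2500 * (H : ℝ) * Real.log (H : ℝ) * Real.log (1 / δ) ≤ Real.log (L : ℝ) / δ) :
    ∃ n q r : ℕ, 0 < n ∧ 14 ≤ q ∧ 98 * H < n * q ∧ H ≤ 2 ^ r ∧ δ ≤ 1 / (2 * (q : ℝ)) ∧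
      H * (q ^ n) ^ r ≤ L ∧
      ((H + 1 : ℕ) : ℝ) * ((n + 1 : ℕ) : ℝ) ^ r ≤ Real.log L ^ (5 * Real.log (H : ℝ)) := by
  have he := Real.exp_one_gt_d9
  have he2 : 7 ≤ Real.exp 1 ^ 2 := by nlinarith
  have hH' : (3 : ℝ) ≤ H := by exact_mod_cast hH
  have hδ1 : 4 * Real.exp 1 ^ 2 ≤ 1 / δ := by
    rw [le_div_iff₀ hδ]
    rw [le_div_iff₀ (by positivity)] at hδ'
    linarith
  set l := Real.log (1 / δ) with hl
  set a := Real.log (H : ℝ) with ha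
  set Λ := Real.log (L : ℝ) with hΛ
  have hl2 : 2 ≤ l := by
    rw [hl, Real.le_log_iff_exp_le (by positivity)]
    refine le_trans ?_ hδ1
    have : Real.exp 2 = Real.exp 1 ^ 2 := by rw [← Real.exp_nat_mul]; norm_num
    rw [this]
    linarith
  have ha1 : 1 ≤ a := by
    rw [ha, Real.le_log_iff_exp_le (by linarith)]
    linarith [Real.exp_one_lt_d9]
  have hL0 : (0 : ℝ) < L := lt_of_lt_of_le (by positivity) hL
  have hΛl : 1700 * l ^ 2 ≤ Λ := by
    have h1 := Real.log_le_log (by positivity) hL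
    rw [Real.log_rpow (by norm_num)] at h1
    nlinarith [Real.log_two_gt_d9, sq_nonneg l]
  have hΛ1 : 6800 ≤ Λ := by nlinarith
  set W := δ * H with hW
  have hW0 : 0 < W := by positivity
  have hΛW : 2500 * (W * a * l) ≤ Λ := by
    rw [le_div_iff₀ hδ] at hHL
    linarith
  have hΛW' : 5000 * W ≤ Λ := by
    have h1 : W * 2 ≤ W * a * l := by
      rw [mul_assoc W a l]
      refine mul_le_mul_of_nonneg_left ?_ hW0.le
      nlinarith
    linarith
  -- This term comes from the 1 in n ≤ 400 W + 1. If log H ≤ 2 log(1/δ), the first summand bounds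
  -- it; otherwise H > 1/δ², so W = δH ≥ 1 and the second does.
  have hal : a * l ≤ 2 * l ^ 2 + W * a * l := by
    by_cases h : a ≤ 2 * l
    · have : 0 ≤ W * a * l := by positivity
      nlinarith
    · push Not at h
      have hW1 : 1 ≤ W := by
        have h1 : Real.log ((1 / δ) ^ 2) < Real.log H := by
          rw [Real.log_pow]
          exact_mod_cast h
        have h2 : (1 / δ) ^ 2 < H := (Real.log_lt_log_iff (by positivity) (by linarith)).1 h1
        have h3 : δ * (1 / δ) ^ 2 = 1 / δ := by field_simp
        have h4 : δ * (1 / δ) ^ 2 ≤ W := mul_le_mul_of_nonneg_left h2.le hδ.le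
        linarith
      have : a * l ≤ W * (a * l) := le_mul_of_one_le_left (by positivity) hW1
      nlinarith
  set q := ⌊1 / (2 * δ)⌋₊ with hq
  set n := ⌊400 * W⌋₊ + 1 with hn
  set r := Nat.clog 2 H with hr
  have h2δ : 1 / (2 * δ) = 1 / δ / 2 := by field_simp
  have hq14 : 14 ≤ q := by
    refine Nat.le_floor ?_
    rw [h2δ]
    push_cast
    linarith
  have hqle : (q : ℝ) ≤ 1 / (2 * δ) := Nat.floor_le (by positivity)
  have hqge : 1 / (4 * δ) ≤ q := by
    have h1 := Nat.lt_floor_add_one (1 / (2 * δ))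
    have h2 : 1 / (4 * δ) = 1 / δ / 4 := by field_simp
    rw [h2δ] at h1
    rw [h2]
    have : (q : ℝ) = (⌊1 / δ / 2⌋₊ : ℝ) := by rw [hq, h2δ]
    linarith
  have hq0 : (0 : ℝ) < q := by exact_mod_cast (by omega : 0 < q)
  have hnle : (n : ℝ) ≤ 400 * W + 1 := by
    rw [hn]
    push_cast
    linarith [Nat.floor_le (by positivity : 0 ≤ 400 * W)]
  have hnge : 400 * W < n := by
    rw [hn]
    push_cast
    exact Nat.lt_floor_add_one _
  have hrle : (r : ℝ) ≤ 3 * a := clog_two_le_mul_log hH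
  refine ⟨n, q, r, by omega, hq14, ?_, Nat.le_pow_clog (by norm_num) _, ?_, ?_, ?_⟩
  · have h1 : (100 : ℝ) * H ≤ n * q := by
      calc (100 : ℝ) * H = 400 * W * (1 / (4 * δ)) := by
            rw [hW]
            field_simp
            ring
        _ ≤ n * q := by gcongr
    have h2 : 100 * H ≤ n * q := by exact_mod_cast h1
    omega
  · rw [le_div_iff₀ (by positivity)]
    rw [le_div_iff₀ (by positivity)] at hqle
    linarith
  · have hlogq : Real.log q ≤ l := by
      refine Real.log_le_log hq0 (hqle.trans ?_)
      rw [h2δ]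
      have : 0 < 1 / δ := by positivity
      linarith
    have hlogq0 : 0 ≤ Real.log q := Real.log_natCast_nonneg q
    have h1 : Real.log ((H : ℝ) * (q ^ n) ^ r) ≤ Λ := by
      rw [Real.log_mul (by linarith) (by positivity), Real.log_pow, Real.log_pow]
      have h2 : (r : ℝ) * (n * Real.log q) ≤ 3 * a * ((400 * W + 1) * l) := by gcongr
      have h3 : a ≤ a * l := le_mul_of_one_le_right (by linarith) (by linarith)
      have h4 : 3 * a * ((400 * W + 1) * l) = 1200 * (W * a * l) + 3 * (a * l) := by ring
      linarith
    have h2 := (Real.log_le_log_iff (by positivity) hL0).1 h1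
    exact_mod_cast h2
  · refine state_count_le hH (by linarith) ?_ hrle
    push_cast
    linarith

/-! ### Assembly of the lower bound -/

theorem theorem3p2 :
    ∃ C : ℝ, 0 < C ∧ ∃ K : ℝ, 0 < K ∧ ∃ c : ℝ, 0 < c ∧
      ∀ (δ : ℝ) (H A L : ℕ),
        0 < δ → δ ≤ 1 / (4 * Real.exp 1 ^ 2) → 3 ≤ H → 2 ≤ A →
        (2 : ℝ) ^ (C * Real.log (1 / δ) ^ 2) ≤ (L : ℝ) →
        C * (H : ℝ) * Real.log (H : ℝ) * Real.log (1 / δ) ≤ Real.log (L : ℝ) / δ →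
        ∃ (𝒮 : Type) (_ : Fintype 𝒮) (𝓜 : Set (LMDP 𝒮 (Fin A) L H)),
          (Fintype.card 𝒮 : ℝ) ≤ Real.log (L : ℝ) ^ (K * Real.log (H : ℝ)) ∧
          (∀ M ∈ 𝓜, M.StronglySeparated δ) ∧
          (∃ R : Fin H → 𝒮 → Fin A → Set.Icc (0 : ℝ) 1, (∀ M ∈ 𝓜, M.reward = R) ∧
            ∀ τ : Trajectory 𝒮 (Fin A) H, ∑ h, (R h (τ h).1 (τ h).2 : ℝ) ≤ 1) ∧
          ∀ (T : ℕ) (Ω : Type) (_ : MeasurableSpace Ω) (P : MeasureTheory.Measure Ω)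
            (_ : MeasureTheory.IsProbabilityMeasure P) (alg : LearningAlg Ω 𝒮 (Fin A) H T),
            (∀ M ∈ 𝓜, 3 / 4 ≤ alg.successProb P M (1 / (4 * (H : ℝ)))) →
            c * (A : ℝ) ^ (H - 2) ≤ (T : ℝ) := by

  refine ⟨2500, by norm_num, 5, by norm_num, 1 / 2, by norm_num, ?_⟩
  intro δ H A L hδ hδ' hH hA hL hHL
  obtain ⟨n, q, r, hn, hq, hnq, hr, hδq, hcard, hsize⟩ := lock_parameter_bounds hδ hδ' hH hL hHL
  obtain ⟨N, rfl⟩ : ∃ N, H = N + 1 := ⟨H - 1, by omega⟩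
  have hN : 0 < N := by omega
  obtain ⟨X, _, hX, _, ⟨F⟩⟩ := exists_hiddenGroups hn hq hnq hr hδq
  obtain ⟨e⟩ : Nonempty (Fin (N + 1) × X ↪ Fin L) := by
    refine Function.Embedding.nonempty_of_card_le ?_
    rw [Fintype.card_prod, Fintype.card_fin, Fintype.card_fin]
    exact (Nat.mul_le_mul_left _ hX).trans hcard
  refine ⟨Option (Fin (N + 1)) × (Fin r → Option (Fin n)), inferInstance,
    Set.range fun s : Fin N → Fin A => F.lockLMDP e (HiddenGroups.secretOf s), ?_, ?_, ?_, ?_⟩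
  · refine le_trans (le_of_eq ?_) hsize
    simp
  · rintro _ ⟨s, rfl⟩
    exact F.stronglySeparated_lockLMDP e _
  · refine ⟨lockReward A N _, ?_, fun τ => ?_⟩
    · rintro _ ⟨s, rfl⟩
      rfl
    · rw [sum_lockReward]
      split_ifs <;> norm_num
  · intro T Ω _ P _ alg halg
    have h1 := F.pow_le_of_successProb hN e P alg fun s => by
      have := halg _ ⟨s, rfl⟩
      rwa [Nat.cast_add, Nat.cast_one] at this
    have hA' : (2 : ℝ) ≤ A := by exact_mod_cast hA
    have h2 : (A : ℝ) ^ (N + 1 - 2) ≤ (A : ℝ) ^ N :=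
      pow_le_pow_right₀ (by linarith) (by omega)
    -- With A^N ≥ 4, the 1 in (3/4) A^N ≤ 1 + T costs at most A^N/4, which leaves c = 1/2.
    have h3 : (4 : ℝ) ≤ (A : ℝ) ^ N :=
      calc (4 : ℝ) = 2 ^ 2 := by norm_num
        _ ≤ (A : ℝ) ^ 2 := by gcongr
        _ ≤ (A : ℝ) ^ N := pow_le_pow_right₀ (by linarith) (by omega)
    linarith
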